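/- Let $c>0$ and consider on $\mathbb{R}^3$ the linear operator $$\mathcal{L}(\phi,u,v)=\big(\operatorname{div}u,\ \nabla\phi+u-v,\ -c\,\mathcal{J}u+cv-\Delta v\big),\qquad \mathcal{J}=\mathrm{I}+\nabla(-\Delta)^{-1}\operatorname{div},$$ acting on states $U=(\phi,u,v)$ with $\phi$ scalar and $u,v$ three-dimensional vector fields. With $\hat f(\xi)=(2\pi)^{-3/2}\int f(x)e^{-ix\cdot\xi}\,dx$, let $B(\xi)$ be the symbol of $\mathcal{L}$, $$B(\xi)=\begin{pmatrix}0&i\xi^t&0\\ i\xi&\mathrm{I}&-\mathrm{I}\\ 0&-c\big(\mathrm{I}-\tfrac{\xi\xi^t}{|\xi|^2}\big)&(c+|\xi|^2)\mathrm{I}\end{pmatrix}.$$ Put $$\lambda_{1,2}=\frac{-1\pm\sqrt{1-4|\xi|^2}}2,\qquad \lambda_{3,4}=\frac{-(c+1+|\xi|^2)\pm\sqrt{(c+1+|\xi|^2)^2-4|\xi|^2}}2,$$ and let $\hat G(t,\xi)=(\hat G_{ik})_{3\times3}$ be the block matrix with $$\hat G_{11}=\frac{\lambda_1e^{\lambda_2t}-\lambda_2e^{\lambda_1t}}{\lambda_1-\lambda_2},\quad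 \hat G_{12}=-i\xi^t\frac{e^{\lambda_1t}-e^{\lambda_2t}}{\lambda_1-\lambda_2},\quad \hat G_{21}=-i\xi\frac{e^{\lambda_1t}-e^{\lambda_2t}}{\lambda_1-\lambda_2},\quad \hat G_{13}=\hat G_{31}=0,$$ $$\hat G_{22}=\frac{(\lambda_3+1)e^{\lambda_4t}-(\lambda_4+1)e^{\lambda_3t}}{\lambda_3-\lambda_4}\Big(\mathrm{I}-\frac{\xi\xi^t}{|\xi|^2}\Big)+\frac{\lambda_1e^{\lambda_1t}-\lambda_2e^{\lambda_2t}}{\lambda_1-\lambda_2}\frac{\xi\xi^t}{|\xi|^2},\quad \hat G_{23}=\frac{e^{\lambda_3t}-e^{\lambda_4t}}{\lambda_3-\lambda_4}\mathrm{I},$$ $$\hat G_{32}=\frac{c(e^{\lambda_3t}-e^{\lambda_4t})}{\lambda_3-\lambda_4}\Big(\mathrm{I}-\frac{\xi\xi^t}{|\xi|^2}\Big),\quad \hat G_{33}=\frac{(\lambda_3+1)e^{\lambda_3t}-(\lambda_4+1)e^{\lambda_4t}}{\lambda_3-\lambda_4}\mathrm{I}.$$ (i) $\hat G$ is the Green function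 of $\mathcal{L}$ on states with $\operatorname{div}v=0$: for all $t\in\mathbb{R}$, all $\xi\neq0$ with $|\xi|\neq\frac12$ and all $z=(z_1,z_2,z_3)\in\mathbb{C}\times\mathbb{C}^3\times\mathbb{C}^3$ with $\xi\cdot z_3=0$, one has $\hat G(t,\xi)z=e^{-tB(\xi)}z$. In (ii) and (iii), $G(t)*f$ denotes the tempered distribution whose Fourier transform is $\hat G(t,\xi)\hat f(\xi)$; derivatives are distributional, $\|\nabla^kT\|_{L^2}=\sum_{|\ell|=k}\|D^\ell T\|_{L^2}$, and $\|T\|_{L^2}=\infty$ if $T$ is not an $L^2$ function. (ii) There is $R>0$ depending only on $c$, and for every integer $k\ge0$ a constant $C>0$ depending only on $c$ and $k$, such that for all $t\ge0$ and all $f\in L^1(\mathbb{R}^3)$ with values in $\mathbb{C}\times\mathbb{C}^3\times\mathbb{C}^3$, $$\|\nabla^k G(t)*f\|_{L^2}\le C(1+t)^{-\frac34-\frac k2}\|f\|_{L^1}+Ce^{-Rt}\|\nabla^kf\|_{L^2}.$$ (iii) For every $R_0>0$ and every integer $k\ge0$ there is $C>0$ depending only on $c$, $R_0$, $k$ such that,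 for every $0<r_0<R_0$ and every $\hat\chi_1\in C^\infty(\mathbb{R}^3)$ with $0\le\hat\chi_1\le1$, $\hat\chi_1=1$ for $|\xi|\le r_0$ and $\hat\chi_1=0$ for $|\xi|\ge R_0$, the low-frequency part $G^\ell$ with symbol $\hat\chi_1\hat G$ satisfies, for all $t\ge0$ and all such $f\in L^1$, $$\|\nabla^k G^\ell(t)*f\|_{L^2}\le C(1+t)^{-\frac34-\frac k2}\|f\|_{L^1}.$$ The estimates (ii) and (iii) also hold, with the same constants, when $\hat G(t,\xi)$ is replaced by $e^{-tB(\xi)}$. -/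

import Mathlib

open MeasureTheory
open scoped ENNReal SchwartzMap FourierTransform LineDeriv Matrix ContDiff

noncomputable section

namespace EulerNS

/-- Physical space and frequency space `ℝ³`. -/
abbrev E3 := EuclideanSpace ℝ (Fin 3)

/-- The seven scalar components of a state `U = (φ, u, v)`: one for the perturbation `φ` of the
logarithm of the density, three for each of the velocities `u` and `v`. -/
abbrev Idx := Unit ⊕ (Fin 3 ⊕ Fin 3)

/-- Values of a state `U = (φ, u, v)`, complexified. -/
abbrev St := EuclideanSpace ℂ Idx

/-! ### The linearized operator and its Green function on the Fourier side

The Fourier transform is normalized so that `∂_j` becomes multiplication by `i ξ_j`. -/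

/-- The frequency `ξ`, as a complex vector. -/
def cvec (ξ : E3) : Fin 3 → ℂ := fun j => (ξ j : ℂ)

/-- `ξ ξᵗ / |ξ|²`, the symbol of the projection onto curl-free fields. -/
def projCurlFree (ξ : E3) : Matrix (Fin 3) (Fin 3) ℂ :=
  (((‖ξ‖ ^ 2)⁻¹ : ℝ) : ℂ) • Matrix.vecMulVec (cvec ξ) (cvec ξ)

/-- `I - ξ ξᵗ / |ξ|²`, the symbol of the projection `𝒥 = I + ∇(-Δ)⁻¹div` onto divergence-free
fields. -/
def projDivFree (ξ : E3) : Matrix (Fin 3) (Fin 3) ℂ := 1 - projCurlFree ξ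

/-- The `3 × 3` block matrix acting on `(φ, u, v)` with blocks of sizes `1, 3, 3`. -/
def block (a₁₁ : ℂ) (a₁₂ a₁₃ : Fin 3 → ℂ)
    (a₂₁ : Fin 3 → ℂ) (a₂₂ a₂₃ : Matrix (Fin 3) (Fin 3) ℂ)
    (a₃₁ : Fin 3 → ℂ) (a₃₂ a₃₃ : Matrix (Fin 3) (Fin 3) ℂ) : Matrix Idx Idx ℂ :=
  Matrix.fromBlocks
    (Matrix.of fun _ _ => a₁₁)
    (Matrix.fromCols (Matrix.replicateRow Unit a₁₂) (Matrix.replicateRow Unit a₁₃))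
    (Matrix.fromRows (Matrix.replicateCol Unit a₂₁) (Matrix.replicateCol Unit a₃₁))
    (Matrix.fromBlocks a₂₂ a₂₃ a₃₂ a₃₃)

/-- The symbol of the linearized operator
`ℒ(φ, u, v) = (div u, ∇φ + u - v, -c 𝒥 u + c v - Δ v)`. -/
def symbolL (c : ℝ) (ξ : E3) : Matrix Idx Idx ℂ :=
  block
    0 (Complex.I • cvec ξ) 0
    (Complex.I • cvec ξ) 1 (-1)
    0 (-((c : ℂ) • projDivFree ξ)) (((c + ‖ξ‖ ^ 2 : ℝ) : ℂ) • 1)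

/-- The symbol `exp (-t ℒ̂(ξ))` of the Green function `e^{-tℒ}` of `ℒ`: the solution of
`∂ₜ Ĝ + ℒ̂ Ĝ = 0`, `Ĝ(0) = I`. -/
def greenExp (c t : ℝ) (ξ : E3) : Matrix Idx Idx ℂ :=
  NormedSpace.exp (-((t : ℂ) • symbolL c ξ))

/-- `√(1 - 4|ξ|²)`, the principal complex root. -/
def disc₁ (ξ : E3) : ℂ := ((1 - 4 * ‖ξ‖ ^ 2 : ℝ) : ℂ) ^ (1 / 2 : ℂ)

/-- `√((c + 1 + |ξ|²)² - 4|ξ|²)`; for `c > 0` the radicand is positive. -/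
def disc₂ (c : ℝ) (ξ : E3) : ℂ := (Real.sqrt ((c + 1 + ‖ξ‖ ^ 2) ^ 2 - 4 * ‖ξ‖ ^ 2) : ℂ)

def eig₁ (ξ : E3) : ℂ := (-1 + disc₁ ξ) / 2

def eig₂ (ξ : E3) : ℂ := (-1 - disc₁ ξ) / 2

def eig₃ (c : ℝ) (ξ : E3) : ℂ := (-((c + 1 + ‖ξ‖ ^ 2 : ℝ) : ℂ) + disc₂ c ξ) / 2

def eig₄ (c : ℝ) (ξ : E3) : ℂ := (-((c + 1 + ‖ξ‖ ^ 2 : ℝ) : ℂ) - disc₂ c ξ) / 2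

/-- The explicit matrix `Ĝ(t, ξ) = (Ĝ_{ik})` that the Hodge decomposition yields. Its entries are
undefined (here: junk) only on the null set where `ξ = 0` or `|ξ| = 1/2`. -/
def greenFormula (c t : ℝ) (ξ : E3) : Matrix Idx Idx ℂ :=
  let l₁ := eig₁ ξ
  let l₂ := eig₂ ξ
  let l₃ := eig₃ c ξ
  let l₄ := eig₄ c ξ
  let e₁ := Complex.exp (l₁ * t)
  let e₂ := Complex.exp (l₂ * t)
  let e₃ := Complex.exp (l₃ * t)
  let e₄ := Complex.exp (l₄ * t)
  block
    ((l₁ * e₂ - l₂ * e₁) / (l₁ - l₂))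
    (-((e₁ - e₂) / (l₁ - l₂) * Complex.I) • cvec ξ)
    0
    (-((e₁ - e₂) / (l₁ - l₂) * Complex.I) • cvec ξ)
    ((((l₃ + 1) * e₄ - (l₄ + 1) * e₃) / (l₃ - l₄)) • projDivFree ξ
      + ((l₁ * e₁ - l₂ * e₂) / (l₁ - l₂)) • projCurlFree ξ)
    (((e₃ - e₄) / (l₃ - l₄)) • 1)
    0
    ((c * (e₃ - e₄) / (l₃ - l₄)) • projDivFree ξ)
    ((((l₃ + 1) * e₃ - (l₄ + 1) * e₄) / (l₃ - l₄)) • 1)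

/-! ### Convolution, derivatives and norms -/

/-- `T = 𝓕⁻¹(m 𝓕 f)` for a matrix symbol `m` and an integrable `f`, as tempered distributions:
the Fourier transform of `T` is the function `m · 𝓕 f`. Mathlib's Fourier transform has the kernel
`e^{-2πi⟨x,w⟩}`, so that the frequency `ξ` of the kernel `e^{-i⟨x,ξ⟩}` is `2πw`. -/
def IsMultiplierImage (m : E3 → Matrix Idx Idx ℂ) (f : Lp St 1 (volume : Measure E3))
    (T : 𝓢'(E3, St)) : Prop :=
  ∀ g : 𝓢(E3, ℂ),
    Integrable (fun w : E3 =>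
      g w • Matrix.toEuclideanLin (m ((2 * Real.pi) • w)) (𝓕 (f : E3 → St) w)) ∧
    (𝓕 T) g = ∫ w : E3,
      g w • Matrix.toEuclideanLin (m ((2 * Real.pi) • w)) (𝓕 (f : E3 → St) w)

/-- The `L²` norm of a tempered distribution: that of the `L²` function representing it, and `∞` if
there is none. -/
def l2Norm (T : 𝓢'(E3, St)) : ℝ≥0∞ :=
  ⨅ (g : Lp St 2 (volume : Measure E3)) (_ : (g : 𝓢'(E3, St)) = T), ‖g‖ₑ

/-- The `j`-th unit vector. -/
def unitVec (j : Fin 3) : E3 := EuclideanSpace.single j 1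

/-- `D^l = ∂₁^{l₁} ∂₂^{l₂} ∂₃^{l₃}` in the sense of distributions. -/
def multiDeriv (l : Fin 3 → ℕ) (T : 𝓢'(E3, St)) : 𝓢'(E3, St) :=
  (fun S : 𝓢'(E3, St) => ∂_{unitVec 0} S)^[l 0]
    ((fun S : 𝓢'(E3, St) => ∂_{unitVec 1} S)^[l 1]
      ((fun S : 𝓢'(E3, St) => ∂_{unitVec 2} S)^[l 2] T))

/-- `‖∇ᵏ T‖_{L²}`, the sum of `‖D^l T‖_{L²}` over the multi-indices `l` with `|l| = k`. -/
def gradNorm (k : ℕ) (T : 𝓢'(E3, St)) : ℝ≥0∞ :=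
  ∑ l ∈ Finset.piAntidiag (Finset.univ : Finset (Fin 3)) k, l2Norm (multiDeriv l T)

/-- A smooth cut-off function onto low frequencies. -/
structure IsLowCutoff (r₀ R₀ : ℝ) (χ : E3 → ℝ) : Prop where
  pos : 0 < r₀
  lt : r₀ < R₀
  smooth : ContDiff ℝ ∞ χ
  nonneg : ∀ ξ, 0 ≤ χ ξ
  le_one : ∀ ξ, χ ξ ≤ 1
  eq_one : ∀ ξ, ‖ξ‖ ≤ r₀ → χ ξ = 1
  eq_zero : ∀ ξ, R₀ ≤ ‖ξ‖ → χ ξ = 0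

end EulerNS

end

noncomputable section

namespace EulerNS

/-! ### Matrix exponentials -/

section MatrixExp

open scoped Matrix.Norms.Operator

/-! For `ξ ≠ 0` the symbol splits along the Hodge decomposition. On states `(p, ξ q, 0)` it acts as
a 2×2 matrix with exponents `λ₁, λ₂`. On states `(0, u, v)` with `u` and `v` orthogonal to `ξ` it
acts as a 2×2 matrix with exponents `λ₃, λ₄`, the same for each direction. A state with `ξ · v = 0`
is therefore a sum of four eigenvectors, and exponentiating them one by one gives the explicit
matrix: `greenFormula_mulVec_eq_greenExp_mulVec`.

The estimates do not use the eigenvalues, whose quotients degenerate at `|ξ| = 1/2`. A Lyapunov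
functional at each frequency, uniformly comparable with the Euclidean length, is dissipated at a
rate proportional to `|ξ|² / (1 + |ξ|²)` (`energyDeriv_le`, resting on `dissipation_lower_bound`).
Grönwall's argument then bounds `greenExp` by a constant times `exp (-r |ξ|² t / (1 + |ξ|²))` on all
states (`norm_greenExp_apply_le`). The explicit matrix differs from the exponential only on the
curl-free part of `v`. There it acts by the same scalars as on transverse `v`, so it inherits the
bound (`norm_greenFormula_apply_le`).

By Plancherel the norms of derivatives are weighted `L²` norms on the Fourier side. For bounded
`|ξ|` the multiplier is dominated by a Gaussian in `√(1 + t) ξ`, and `|f̂| ≤ ‖f‖_{L¹}`, so scaling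
in dimension three gives `(1 + t)^(-3/4 - k/2)`. For `|ξ| ≥ 1` the rate is at least `1/2`, which
leaves an exponentially small multiple of `‖∇ᵏ f‖`. -/

theorem matrix_exp_mulVec_eigenvector {n : Type*} [Fintype n] [DecidableEq n]
    (A : Matrix n n ℂ) (w : n → ℂ) (l : ℂ) (h : A *ᵥ w = l • w) :
    NormedSpace.exp A *ᵥ w = Complex.exp l • w := by
  have hpow : ∀ k : ℕ, (A ^ k) *ᵥ w = l ^ k • w := by
    intro k
    induction k with
    | zero => simp
    | succ k ih => rw [pow_succ, ← Matrix.mulVec_mulVec, h, Matrix.mulVec_smul, ih, smul_smul,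
        pow_succ, mul_comm]
  let Φ : Matrix n n ℂ →L[ℂ] (n → ℂ) :=
    LinearMap.toContinuousLinearMap ((Matrix.mulVecBilin ℂ ℂ).flip w)
  have hΦ : ∀ M : Matrix n n ℂ, Φ M = M *ᵥ w := fun M => rfl
  have h1 := (NormedSpace.exp_series_hasSum_exp' (𝕂 := ℂ) A).mapL Φ
  have h2 := (NormedSpace.exp_series_hasSum_exp' (𝕂 := ℂ) l).smul_const w
  rw [← Complex.exp_eq_exp_ℂ] at h2
  rw [← hΦ]
  refine h1.unique ?_
  convert! h2 using 2 with k
  rw [map_smul, hΦ, hpow, smul_assoc]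

/-- This is the evolution equation along which the Lyapunov functional is differentiated. -/
theorem hasDerivAt_matrix_exp_mulVec {n : Type*} [Fintype n] [DecidableEq n]
    (A : Matrix n n ℂ) (w : n → ℂ) (t : ℝ) :
    HasDerivAt (fun s : ℝ => NormedSpace.exp (-((s : ℂ) • A)) *ᵥ w)
      (-(A *ᵥ (NormedSpace.exp (-((t : ℂ) • A)) *ᵥ w))) t := by
  let Φ : Matrix n n ℂ →L[ℂ] (n → ℂ) :=
    LinearMap.toContinuousLinearMap ((Matrix.mulVecBilin ℂ ℂ).flip w)
  have hΦ : ∀ M : Matrix n n ℂ, Φ M = M *ᵥ w := fun M => rfl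
  have h1 := (hasDerivAt_exp_smul_const' (𝕂 := ℝ) (-A) t)
  have h2 := (Φ.restrictScalars ℝ).hasFDerivAt.comp_hasDerivAt t h1
  have hs : ∀ s : ℝ, s • -A = -((s : ℂ) • A) := fun s => by ext i j; simp
  simp only [hs] at h2
  convert! h2 using 1
  change _ = (-A * NormedSpace.exp (-((t : ℂ) • A))) *ᵥ w
  rw [Matrix.mulVec_mulVec, Matrix.neg_mul, Matrix.neg_mulVec]

end MatrixExp

theorem continuous_matrix_exp {n : Type*} [Fintype n] [DecidableEq n] :
    Continuous (NormedSpace.exp : Matrix n n ℂ → Matrix n n ℂ) := by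
  open scoped Matrix.Norms.Operator in exact NormedSpace.exp_continuous

/-! ### The symbol and the explicit Green matrix, componentwise -/

/-- `ξ · u` for the `u`-part of a state. -/
def divU (ξ : E3) (z : Idx → ℂ) : ℂ := ∑ j : Fin 3, (ξ j : ℂ) * z (Sum.inr (Sum.inl j))

/-- `ξ · v` for the `v`-part of a state. -/
def divV (ξ : E3) (z : Idx → ℂ) : ℂ := ∑ j : Fin 3, (ξ j : ℂ) * z (Sum.inr (Sum.inr j))

theorem norm_sq_eq_sum (ξ : E3) : ‖ξ‖ ^ 2 = ∑ j : Fin 3, ξ j ^ 2 := by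
  simp [EuclideanSpace.norm_sq_eq]

section Block

variable (a₁₁ : ℂ) (a₁₂ a₁₃ a₂₁ : Fin 3 → ℂ) (a₂₂ a₂₃ : Matrix (Fin 3) (Fin 3) ℂ)
    (a₃₁ : Fin 3 → ℂ) (a₃₂ a₃₃ : Matrix (Fin 3) (Fin 3) ℂ) (z : Idx → ℂ)

theorem block_mulVec_inl (i : Unit) :
    (block a₁₁ a₁₂ a₁₃ a₂₁ a₂₂ a₂₃ a₃₁ a₃₂ a₃₃ *ᵥ z) (Sum.inl i) =
      a₁₁ * z (Sum.inl ()) + ((∑ j, a₁₂ j * z (Sum.inr (Sum.inl j)))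
        + ∑ j, a₁₃ j * z (Sum.inr (Sum.inr j))) := by
  simp [block, Matrix.mulVec, dotProduct, Fintype.sum_sum_type, Matrix.fromCols]

theorem block_mulVec_inr_inl (i : Fin 3) :
    (block a₁₁ a₁₂ a₁₃ a₂₁ a₂₂ a₂₃ a₃₁ a₃₂ a₃₃ *ᵥ z) (Sum.inr (Sum.inl i)) =
      a₂₁ i * z (Sum.inl ()) + ((∑ j, a₂₂ i j * z (Sum.inr (Sum.inl j)))
        + ∑ j, a₂₃ i j * z (Sum.inr (Sum.inr j))) := by
  simp [block, Matrix.mulVec, dotProduct, Fintype.sum_sum_type]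

theorem block_mulVec_inr_inr (i : Fin 3) :
    (block a₁₁ a₁₂ a₁₃ a₂₁ a₂₂ a₂₃ a₃₁ a₃₂ a₃₃ *ᵥ z) (Sum.inr (Sum.inr i)) =
      a₃₁ i * z (Sum.inl ()) + ((∑ j, a₃₂ i j * z (Sum.inr (Sum.inl j)))
        + ∑ j, a₃₃ i j * z (Sum.inr (Sum.inr j))) := by
  simp [block, Matrix.mulVec, dotProduct, Fintype.sum_sum_type]

end Block

theorem sum_projCurlFree_mul (ξ : E3) (u : Fin 3 → ℂ) (i : Fin 3) :
    ∑ j, projCurlFree ξ i j * u j =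
      (((‖ξ‖ ^ 2)⁻¹ : ℝ) : ℂ) * (ξ i : ℂ) * ∑ j, (ξ j : ℂ) * u j := by
  simp only [projCurlFree, Matrix.smul_apply, Matrix.vecMulVec_apply, cvec, smul_eq_mul,
    Finset.mul_sum]
  exact Finset.sum_congr rfl fun j _ => by ring

theorem sum_projDivFree_mul (ξ : E3) (u : Fin 3 → ℂ) (i : Fin 3) :
    ∑ j, projDivFree ξ i j * u j =
      u i - (((‖ξ‖ ^ 2)⁻¹ : ℝ) : ℂ) * (ξ i : ℂ) * ∑ j, (ξ j : ℂ) * u j := by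
  simp only [projDivFree, Matrix.sub_apply, sub_mul, Finset.sum_sub_distrib, sum_projCurlFree_mul]
  simp [Matrix.one_apply]

theorem symbolL_mulVec_inl (c : ℝ) (ξ : E3) (z : Idx → ℂ) (i : Unit) :
    (symbolL c ξ *ᵥ z) (Sum.inl i) = Complex.I * divU ξ z := by
  simp [symbolL, block_mulVec_inl, divU, cvec, Finset.mul_sum, mul_assoc]

theorem symbolL_mulVec_inr_inl (c : ℝ) (ξ : E3) (z : Idx → ℂ) (i : Fin 3) :
    (symbolL c ξ *ᵥ z) (Sum.inr (Sum.inl i)) =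
      Complex.I * ξ i * z (Sum.inl ()) + z (Sum.inr (Sum.inl i)) - z (Sum.inr (Sum.inr i)) := by
  simp [symbolL, block_mulVec_inr_inl, cvec, Matrix.one_apply, Matrix.neg_apply]
  ring

theorem symbolL_mulVec_inr_inr (c : ℝ) (ξ : E3) (z : Idx → ℂ) (i : Fin 3) :
    (symbolL c ξ *ᵥ z) (Sum.inr (Sum.inr i)) =
      -(c : ℂ) * (z (Sum.inr (Sum.inl i)) - (((‖ξ‖ ^ 2)⁻¹ : ℝ) : ℂ) * (ξ i : ℂ) * divU ξ z)
        + ((c + ‖ξ‖ ^ 2 : ℝ) : ℂ) * z (Sum.inr (Sum.inr i)) := by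
  have h := sum_projDivFree_mul ξ (fun j => z (Sum.inr (Sum.inl j))) i
  simp only [symbolL, block_mulVec_inr_inr, Matrix.neg_apply, Matrix.smul_apply, smul_eq_mul,
    neg_mul, mul_assoc, Finset.sum_neg_distrib, ← Finset.mul_sum, h, divU]
  simp [Matrix.one_apply]

/-! ### Discriminants and the spectral decomposition -/

theorem disc₁_sq (ξ : E3) : disc₁ ξ ^ 2 = 1 - 4 * (‖ξ‖ : ℂ) ^ 2 := by
  rw [disc₁, ← Complex.cpow_nat_mul]
  norm_num

/-- With `s = |ξ|²` the radicand is `(1 - s)² + 2c(1 + s) + c²`. Hence `λ₃ ≠ λ₄` at every frequency,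
and only `λ₁ = λ₂` forces a sphere to be excluded. -/
theorem disc₂_radicand_pos {c : ℝ} (hc : 0 < c) (ξ : E3) :
    0 < (c + 1 + ‖ξ‖ ^ 2) ^ 2 - 4 * ‖ξ‖ ^ 2 := by
  nlinarith [sq_nonneg (‖ξ‖ ^ 2 - 1), sq_nonneg ‖ξ‖, mul_nonneg hc.le (sq_nonneg ‖ξ‖)]

theorem disc₂_sq {c : ℝ} (hc : 0 < c) (ξ : E3) :
    disc₂ c ξ ^ 2 = ((c : ℂ) + 1 + (‖ξ‖ : ℂ) ^ 2) ^ 2 - 4 * (‖ξ‖ : ℂ) ^ 2 := by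
  rw [disc₂, ← Complex.ofReal_pow, Real.sq_sqrt (disc₂_radicand_pos hc ξ).le]
  push_cast
  ring

theorem disc₂_ne_zero {c : ℝ} (hc : 0 < c) (ξ : E3) : disc₂ c ξ ≠ 0 := by
  rw [disc₂, Complex.ofReal_ne_zero]
  exact (Real.sqrt_pos.2 (disc₂_radicand_pos hc ξ)).ne'

theorem disc₁_ne_zero {ξ : E3} (h : ‖ξ‖ ≠ 1 / 2) : disc₁ ξ ≠ 0 := by
  intro h0
  have h1 := disc₁_sq ξ
  rw [h0, zero_pow two_ne_zero] at h1
  have h2 : (0 : ℝ) = 1 - 4 * ‖ξ‖ ^ 2 := by exact_mod_cast h1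
  apply h
  nlinarith [norm_nonneg ξ]

/-- Solutions of the longitudinal part: eigenvectors `(p, ξ q, 0)`. -/
theorem greenExp_mulVec_longitudinal (c t : ℝ) {ξ : E3} (hξ : ξ ≠ 0) (l p q : ℂ)
    (h₁ : -(Complex.I * (‖ξ‖ : ℂ) ^ 2 * q) = l * p) (h₂ : -(Complex.I * p) - q = l * q) :
    greenExp c t ξ *ᵥ Sum.elim (fun _ => p) (Sum.elim (fun j => (ξ j : ℂ) * q) fun _ => 0) =
      Complex.exp (l * t) •
        Sum.elim (fun _ => p) (Sum.elim (fun j => (ξ j : ℂ) * q) fun _ => 0) := by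
  have hs : (‖ξ‖ : ℂ) ≠ 0 := by simpa using hξ
  have hs2 : (‖ξ‖ : ℂ) ^ 2 = ∑ j : Fin 3, (ξ j : ℂ) ^ 2 := by
    exact_mod_cast congrArg (Complex.ofReal) (norm_sq_eq_sum ξ)
  refine matrix_exp_mulVec_eigenvector _ _ _ ?_
  set w : Idx → ℂ := Sum.elim (fun _ => p) (Sum.elim (fun j => (ξ j : ℂ) * q) fun _ => 0) with hw
  have hd : divU ξ w = (‖ξ‖ : ℂ) ^ 2 * q := by
    simp only [divU, hw, Sum.elim_inr, Sum.elim_inl, hs2, Finset.sum_mul]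
    exact Finset.sum_congr rfl fun j _ => by ring
  rw [Matrix.neg_mulVec, Matrix.smul_mulVec]
  ext i
  rcases i with i | i | i
  · simp only [Pi.neg_apply, Pi.smul_apply, smul_eq_mul, symbolL_mulVec_inl, hd]
    simp only [hw, Sum.elim_inl]
    linear_combination (t : ℂ) * h₁
  · simp only [Pi.neg_apply, Pi.smul_apply, smul_eq_mul, symbolL_mulVec_inr_inl]
    simp only [hw, Sum.elim_inl, Sum.elim_inr]
    linear_combination (t : ℂ) * ξ i * h₂
  · simp only [Pi.neg_apply, Pi.smul_apply, smul_eq_mul, symbolL_mulVec_inr_inr, hd]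
    simp only [hw, Sum.elim_inl, Sum.elim_inr]
    push_cast
    field_simp
    ring

/-- Solutions of the transverse part: eigenvectors `(0, u, v)` with `ξ · u = 0`. -/
theorem greenExp_mulVec_transverse (c t : ℝ) (ξ : E3) (l : ℂ) (u v : Fin 3 → ℂ)
    (hu : ∑ j, (ξ j : ℂ) * u j = 0)
    (h₁ : ∀ j, -u j + v j = l * u j)
    (h₂ : ∀ j, (c : ℂ) * u j - (c + (‖ξ‖ : ℂ) ^ 2) * v j = l * v j) :
    greenExp c t ξ *ᵥ Sum.elim (fun _ => 0) (Sum.elim u v) =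
      Complex.exp (l * t) • Sum.elim (fun _ => 0) (Sum.elim u v) := by
  refine matrix_exp_mulVec_eigenvector _ _ _ ?_
  set w : Idx → ℂ := Sum.elim (fun _ => 0) (Sum.elim u v) with hw
  have hd : divU ξ w = 0 := by simpa [divU, hw] using hu
  rw [Matrix.neg_mulVec, Matrix.smul_mulVec]
  ext i
  rcases i with i | i | i
  · simp only [Pi.neg_apply, Pi.smul_apply, symbolL_mulVec_inl, hd]
    simp [hw]
  · simp only [Pi.neg_apply, Pi.smul_apply, smul_eq_mul, symbolL_mulVec_inr_inl]
    simp only [hw, Sum.elim_inl, Sum.elim_inr]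
    linear_combination (t : ℂ) * h₁ i
  · simp only [Pi.neg_apply, Pi.smul_apply, smul_eq_mul, symbolL_mulVec_inr_inr, hd]
    simp only [hw, Sum.elim_inr, Sum.elim_inl]
    push_cast
    linear_combination (t : ℂ) * h₂ i

theorem greenFormula_mulVec_inl (c t : ℝ) (ξ : E3) (z : Idx → ℂ) (i : Unit) :
    (greenFormula c t ξ *ᵥ z) (Sum.inl i) =
      (eig₁ ξ * Complex.exp (eig₂ ξ * t) - eig₂ ξ * Complex.exp (eig₁ ξ * t)) /
          (eig₁ ξ - eig₂ ξ) * z (Sum.inl ())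
        - (Complex.exp (eig₁ ξ * t) - Complex.exp (eig₂ ξ * t)) / (eig₁ ξ - eig₂ ξ) * Complex.I
          * divU ξ z := by
  simp only [greenFormula, block_mulVec_inl, Pi.smul_apply, cvec, smul_eq_mul, Pi.zero_apply,
    zero_mul, Finset.sum_const_zero, mul_assoc, ← Finset.mul_sum, divU]
  ring

theorem greenFormula_mulVec_inr_inl (c t : ℝ) (ξ : E3) (z : Idx → ℂ) (i : Fin 3) :
    (greenFormula c t ξ *ᵥ z) (Sum.inr (Sum.inl i)) =
      -((Complex.exp (eig₁ ξ * t) - Complex.exp (eig₂ ξ * t)) / (eig₁ ξ - eig₂ ξ) * Complex.I)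
          * ξ i * z (Sum.inl ())
        + ((eig₃ c ξ + 1) * Complex.exp (eig₄ c ξ * t) - (eig₄ c ξ + 1) * Complex.exp (eig₃ c ξ * t))
          / (eig₃ c ξ - eig₄ c ξ)
          * (z (Sum.inr (Sum.inl i)) - (((‖ξ‖ ^ 2)⁻¹ : ℝ) : ℂ) * (ξ i : ℂ) * divU ξ z)
        + (eig₁ ξ * Complex.exp (eig₁ ξ * t) - eig₂ ξ * Complex.exp (eig₂ ξ * t)) /
          (eig₁ ξ - eig₂ ξ) * ((((‖ξ‖ ^ 2)⁻¹ : ℝ) : ℂ) * (ξ i : ℂ) * divU ξ z)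
        + (Complex.exp (eig₃ c ξ * t) - Complex.exp (eig₄ c ξ * t)) / (eig₃ c ξ - eig₄ c ξ)
          * z (Sum.inr (Sum.inr i)) := by
  have h := sum_projDivFree_mul ξ (fun j => z (Sum.inr (Sum.inl j))) i
  have h' := sum_projCurlFree_mul ξ (fun j => z (Sum.inr (Sum.inl j))) i
  simp only [greenFormula, block_mulVec_inr_inl, Matrix.add_apply, Matrix.smul_apply, smul_eq_mul,
    add_mul, mul_assoc, Finset.sum_add_distrib, ← Finset.mul_sum, h, h', divU, Pi.smul_apply, cvec]
  simp only [Matrix.one_apply, ite_mul, one_mul, zero_mul, Finset.sum_ite_eq, Finset.mem_univ,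
    if_true]
  ring

theorem greenFormula_mulVec_inr_inr (c t : ℝ) (ξ : E3) (z : Idx → ℂ) (i : Fin 3) :
    (greenFormula c t ξ *ᵥ z) (Sum.inr (Sum.inr i)) =
      c * (Complex.exp (eig₃ c ξ * t) - Complex.exp (eig₄ c ξ * t)) / (eig₃ c ξ - eig₄ c ξ)
          * (z (Sum.inr (Sum.inl i)) - (((‖ξ‖ ^ 2)⁻¹ : ℝ) : ℂ) * (ξ i : ℂ) * divU ξ z)
        + ((eig₃ c ξ + 1) * Complex.exp (eig₃ c ξ * t) - (eig₄ c ξ + 1) * Complex.exp (eig₄ c ξ * t))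
          / (eig₃ c ξ - eig₄ c ξ) * z (Sum.inr (Sum.inr i)) := by
  have h := sum_projDivFree_mul ξ (fun j => z (Sum.inr (Sum.inl j))) i
  simp only [greenFormula, block_mulVec_inr_inr, Matrix.smul_apply, smul_eq_mul, Pi.zero_apply,
    mul_assoc, ← Finset.mul_sum, h, divU]
  simp only [Matrix.one_apply, ite_mul, one_mul, zero_mul, Finset.sum_ite_eq, Finset.mem_univ,
    if_true]
  ring

/-- The state is the sum of its four spectral components, each multiplied by its own exponential.
About `disc₁` only its square and its nonvanishing matter, so real and complex roots are treated
alike. -/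
theorem greenFormula_mulVec_eq_greenExp_mulVec {c : ℝ} (hc : 0 < c) (t : ℝ) {ξ : E3} (hξ : ξ ≠ 0)
    (hξ' : ‖ξ‖ ≠ 1 / 2) (z : Idx → ℂ) (hz : divV ξ z = 0) :
    greenFormula c t ξ *ᵥ z = greenExp c t ξ *ᵥ z := by
  have hs : (‖ξ‖ : ℂ) ≠ 0 := by simpa using hξ
  have hs2 : ∑ j : Fin 3, (ξ j : ℂ) ^ 2 = (‖ξ‖ : ℂ) ^ 2 := by
    exact_mod_cast congrArg (Complex.ofReal) (norm_sq_eq_sum ξ).symm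
  have hd₁ := disc₁_ne_zero hξ'
  have hd₂ := disc₂_ne_zero hc ξ
  have hq₁ := disc₁_sq ξ
  have hq₂ := disc₂_sq hc ξ
  set a := divU ξ z with ha
  set φ := z (Sum.inl ()) with hφ
  set s := (‖ξ‖ : ℂ) with hsdef
  set d := disc₁ ξ with hd
  set e := disc₂ c ξ with he
  have e₁ : eig₁ ξ = (-1 + d) / 2 := rfl
  have e₂ : eig₂ ξ = (-1 - d) / 2 := rfl
  have e₃ : eig₃ c ξ = (-(c + 1 + s ^ 2) + e) / 2 := by simp [eig₃, hsdef, he]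
  have e₄ : eig₄ c ξ = (-(c + 1 + s ^ 2) - e) / 2 := by simp [eig₄, hsdef, he]
  have e₁₂ : eig₁ ξ - eig₂ ξ = d := by rw [e₁, e₂]; ring
  have e₃₄ : eig₃ c ξ - eig₄ c ξ = e := by rw [e₃, e₄]; ring
  let uT : Fin 3 → ℂ := fun i => z (Sum.inr (Sum.inl i)) - (s ^ 2)⁻¹ * ξ i * a
  let v : Fin 3 → ℂ := fun i => z (Sum.inr (Sum.inr i))
  have huT : ∑ j, (ξ j : ℂ) * uT j = 0 := by
    have : ∀ j, (ξ j : ℂ) * uT j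
        = ξ j * z (Sum.inr (Sum.inl j)) - (ξ j : ℂ) ^ 2 * ((s ^ 2)⁻¹ * a) := fun j => by
      simp only [uT]; ring
    simp only [this, Finset.sum_sub_distrib, ← Finset.sum_mul, hs2]
    rw [← divU, ← ha]
    field_simp
    ring
  have hv : ∑ j, (ξ j : ℂ) * v j = 0 := hz
  have huv : ∀ x y : ℂ, ∑ j, (ξ j : ℂ) * (x * uT j + y * v j) = 0 := by
    intro x y
    have : ∀ j, (ξ j : ℂ) * (x * uT j + y * v j) = x * (ξ j * uT j) + y * (ξ j * v j) :=
      fun j => by ring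
    simp only [this, Finset.sum_add_distrib, ← Finset.mul_sum, huT, hv]
    ring
  -- The components come from the spectral projections `(A - λ₂)/(λ₁ - λ₂)` and `(A - λ₁)/(λ₂ - λ₁)`
  -- of the longitudinal 2×2 matrix, applied to `(φ, ξ·u/|ξ|²)` and simplified by `λ₁ + λ₂ = -1`.
  -- The transverse ones below arise in the same way from `λ₃ + λ₄ = -(c + 1 + |ξ|²)`.
  have E₁ := greenExp_mulVec_longitudinal c t hξ (eig₁ ξ) ((-eig₂ ξ * φ - Complex.I * a) / d)
    ((-Complex.I * φ + eig₁ ξ * a / s ^ 2) / d)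
    (by rw [e₁, e₂]; field_simp; linear_combination -s ^ 2 * φ * hq₁ + 4 * s ^ 4 * φ * Complex.I_sq)
    (by rw [e₁, e₂]; field_simp; linear_combination -a * hq₁ + 4 * a * s ^ 2 * Complex.I_sq)
  have E₂ := greenExp_mulVec_longitudinal c t hξ (eig₂ ξ) ((eig₁ ξ * φ + Complex.I * a) / d)
    ((Complex.I * φ - eig₂ ξ * a / s ^ 2) / d)
    (by rw [e₁, e₂]; field_simp; linear_combination s ^ 2 * φ * hq₁ - 4 * s ^ 4 * φ * Complex.I_sq)
    (by rw [e₁, e₂]; field_simp; linear_combination a * hq₁ - 4 * a * s ^ 2 * Complex.I_sq)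
  have E₃ := greenExp_mulVec_transverse c t ξ (eig₃ c ξ)
    (fun j => -(eig₄ c ξ + 1) / e * uT j + 1 / e * v j)
    (fun j => c / e * uT j + (eig₃ c ξ + 1) / e * v j) (huv _ _)
    (fun j => by rw [e₃, e₄]; field_simp; linear_combination -uT j * hq₂)
    (fun j => by rw [e₃, e₄]; field_simp; linear_combination -v j * hq₂)
  have E₄ := greenExp_mulVec_transverse c t ξ (eig₄ c ξ)
    (fun j => (eig₃ c ξ + 1) / e * uT j + -1 / e * v j)
    (fun j => -c / e * uT j + -(eig₄ c ξ + 1) / e * v j) (huv _ _)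
    (fun j => by rw [e₃, e₄]; field_simp; linear_combination uT j * hq₂)
    (fun j => by rw [e₃, e₄]; field_simp; linear_combination v j * hq₂)
  have hsum := congrArg₂ (· + ·) (congrArg₂ (· + ·) E₁ E₂) (congrArg₂ (· + ·) E₃ E₄)
  simp only [← Matrix.mulVec_add] at hsum
  have hS : ((((‖ξ‖ ^ 2)⁻¹ : ℝ) : ℂ)) = (s ^ 2)⁻¹ := by push_cast; rfl
  -- Two claims remain: the four evolved components add up to the explicit formula, and the four
  -- initial components add up to `z`.
  convert! hsum.symm using 1
  · ext i
    rcases i with i | i | i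
    · simp only [greenFormula_mulVec_inl, e₁₂, Pi.add_apply, Pi.smul_apply, Sum.elim_inl,
        smul_eq_mul]
      ring
    · simp only [greenFormula_mulVec_inr_inl, e₁₂, e₃₄, Pi.add_apply, Pi.smul_apply, Sum.elim_inl,
        Sum.elim_inr, smul_eq_mul, hS, uT, v]
      ring
    · simp only [greenFormula_mulVec_inr_inr, e₃₄, Pi.add_apply, Pi.smul_apply,
        Sum.elim_inr, smul_eq_mul, hS, uT, v]
      ring
  · congr 1
    ext i
    rcases i with i | i | i
    · simp only [Pi.add_apply, Sum.elim_inl]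
      rw [e₁, e₂]
      field_simp
      ring
    · simp only [Pi.add_apply, Sum.elim_inl, Sum.elim_inr, uT, v]
      rw [e₁, e₂, e₃, e₄]
      field_simp
      ring
    · simp only [Pi.add_apply, Sum.elim_inr, uT, v]
      rw [e₃, e₄]
      field_simp
      ring

/-! ### The energy method -/

/-- The squared Euclidean length of a state. -/
def sizeSq (z : Idx → ℂ) : ℝ :=
  Complex.normSq (z (Sum.inl ())) + ∑ j : Fin 3, Complex.normSq (z (Sum.inr (Sum.inl j)))
    + ∑ j : Fin 3, Complex.normSq (z (Sum.inr (Sum.inr j)))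

/-- A Lyapunov functional: a weighted `ℓ²` norm, corrected by a term coupling `φ` and `div u`
which recovers the dissipation of `φ`. -/
def energy (c : ℝ) (ξ : E3) (z : Idx → ℂ) : ℝ :=
  c * Complex.normSq (z (Sum.inl ()))
    + c * ∑ j : Fin 3, Complex.normSq (z (Sum.inr (Sum.inl j)))
    + ∑ j : Fin 3, Complex.normSq (z (Sum.inr (Sum.inr j)))
    + c / 2 / (1 + ‖ξ‖ ^ 2) *
      ((divU ξ z).im * (z (Sum.inl ())).re - (divU ξ z).re * (z (Sum.inl ())).im)

/-- The derivative of `energy c ξ` at `z` in the direction `w`. -/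
def energyDeriv (c : ℝ) (ξ : E3) (z w : Idx → ℂ) : ℝ :=
  c * (2 * ((z (Sum.inl ())).re * (w (Sum.inl ())).re + (z (Sum.inl ())).im * (w (Sum.inl ())).im))
    + c * ∑ j : Fin 3, 2 * ((z (Sum.inr (Sum.inl j))).re * (w (Sum.inr (Sum.inl j))).re
        + (z (Sum.inr (Sum.inl j))).im * (w (Sum.inr (Sum.inl j))).im)
    + ∑ j : Fin 3, 2 * ((z (Sum.inr (Sum.inr j))).re * (w (Sum.inr (Sum.inr j))).re
        + (z (Sum.inr (Sum.inr j))).im * (w (Sum.inr (Sum.inr j))).im)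
    + c / 2 / (1 + ‖ξ‖ ^ 2) *
      ((divU ξ w).im * (z (Sum.inl ())).re + (divU ξ z).im * (w (Sum.inl ())).re
        - ((divU ξ w).re * (z (Sum.inl ())).im + (divU ξ z).re * (w (Sum.inl ())).im))

theorem sizeSq_nonneg (z : Idx → ℂ) : 0 ≤ sizeSq z :=
  add_nonneg (add_nonneg (Complex.normSq_nonneg _)
    (Finset.sum_nonneg fun _ _ => Complex.normSq_nonneg _))
    (Finset.sum_nonneg fun _ _ => Complex.normSq_nonneg _)

theorem hasDerivAt_normSq {f : ℝ → ℂ} {f' : ℂ} {t : ℝ} (hf : HasDerivAt f f' t) :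
    HasDerivAt (fun s => Complex.normSq (f s)) (2 * ((f t).re * f'.re + (f t).im * f'.im)) t := by
  have hr : HasDerivAt (fun s => (f s).re) f'.re t :=
    Complex.reCLM.hasFDerivAt.comp_hasDerivAt t hf
  have hi : HasDerivAt (fun s => (f s).im) f'.im t :=
    Complex.imCLM.hasFDerivAt.comp_hasDerivAt t hf
  simp only [Complex.normSq_apply]
  convert! (hr.mul hr).add (hi.mul hi) using 1
  ring

theorem hasDerivAt_energy (c : ℝ) (ξ : E3) {Z : ℝ → Idx → ℂ} {Z' : Idx → ℂ} {t : ℝ}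
    (hZ : HasDerivAt Z Z' t) :
    HasDerivAt (fun s => energy c ξ (Z s)) (energyDeriv c ξ (Z t) Z') t := by
  have h := hasDerivAt_pi.1 hZ
  have hd : HasDerivAt (fun s => divU ξ (Z s)) (divU ξ Z') t :=
    HasDerivAt.fun_sum fun j _ => (h (Sum.inr (Sum.inl j))).const_mul _
  have hr : HasDerivAt (fun s => (Z s (Sum.inl ())).re) (Z' (Sum.inl ())).re t :=
    Complex.reCLM.hasFDerivAt.comp_hasDerivAt t (h _)
  have hi : HasDerivAt (fun s => (Z s (Sum.inl ())).im) (Z' (Sum.inl ())).im t :=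
    Complex.imCLM.hasFDerivAt.comp_hasDerivAt t (h _)
  have hdr : HasDerivAt (fun s => (divU ξ (Z s)).re) (divU ξ Z').re t :=
    Complex.reCLM.hasFDerivAt.comp_hasDerivAt t hd
  have hdi : HasDerivAt (fun s => (divU ξ (Z s)).im) (divU ξ Z').im t :=
    Complex.imCLM.hasFDerivAt.comp_hasDerivAt t hd
  exact ((((hasDerivAt_normSq (h _)).const_mul c).add
    ((HasDerivAt.fun_sum fun j _ => hasDerivAt_normSq (h _)).const_mul c)).add
    (HasDerivAt.fun_sum fun j _ => hasDerivAt_normSq (h _))).add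
    (((hdi.mul hr).sub (hdr.mul hi)).const_mul _)

theorem normSq_sum_real_mul_le (ξ : E3) (u : Fin 3 → ℂ) :
    Complex.normSq (∑ j, (ξ j : ℂ) * u j) ≤ ‖ξ‖ ^ 2 * ∑ j, Complex.normSq (u j) := by
  have hr := Finset.sum_mul_sq_le_sq_mul_sq Finset.univ (fun j => ξ j) (fun j => (u j).re)
  have hi := Finset.sum_mul_sq_le_sq_mul_sq Finset.univ (fun j => ξ j) (fun j => (u j).im)
  have h : Complex.normSq (∑ j, (ξ j : ℂ) * u j)
      = (∑ j, ξ j * (u j).re) ^ 2 + (∑ j, ξ j * (u j).im) ^ 2 := by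
    rw [Complex.normSq_apply]
    simp [sq]
  have h' : ∑ j, Complex.normSq (u j) = ∑ j, (u j).re ^ 2 + ∑ j, (u j).im ^ 2 := by
    rw [← Finset.sum_add_distrib]
    exact Finset.sum_congr rfl fun j _ => by rw [Complex.normSq_apply]; ring
  rw [h, h', norm_sq_eq_sum, mul_add]
  exact add_le_add hr hi

/-- Cauchy–Schwarz bounds the coupling by `|ξ||u||φ|`; then `|ξ| ≤ (1 + |ξ|²)/2` and `|u||φ| ≤ (|u|²
+ |φ|²)/2`. The weight `c / 2 / (1 + |ξ|²)` in `energy` thus makes the coupling at most one eighth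
of the main terms in `φ` and `u`, uniformly in `ξ`. -/
theorem abs_energy_coupling_le (ξ : E3) (z : Idx → ℂ) :
    |(divU ξ z).im * (z (Sum.inl ())).re - (divU ξ z).re * (z (Sum.inl ())).im| ≤
      (1 + ‖ξ‖ ^ 2) / 4 * (Complex.normSq (z (Sum.inl ()))
        + ∑ j : Fin 3, Complex.normSq (z (Sum.inr (Sum.inl j)))) := by
  have hU := normSq_sum_real_mul_le ξ (fun j => z (Sum.inr (Sum.inl j)))
  rw [← divU] at hU
  have hN := Complex.normSq_nonneg (z (Sum.inl ()))
  have hUn : 0 ≤ ∑ j : Fin 3, Complex.normSq (z (Sum.inr (Sum.inl j))) :=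
    Finset.sum_nonneg fun _ _ => Complex.normSq_nonneg _
  have hN' := Complex.normSq_apply (z (Sum.inl ()))
  rw [Complex.normSq_apply (divU ξ z)] at hU
  set N := Complex.normSq (z (Sum.inl ()))
  set U := ∑ j : Fin 3, Complex.normSq (z (Sum.inr (Sum.inl j)))
  set s := ‖ξ‖ ^ 2
  have hs : 0 ≤ s := sq_nonneg _
  set p := (divU ξ z).re
  set q := (divU ξ z).im
  set x := (z (Sum.inl ())).re
  set y := (z (Sum.inl ())).im
  apply abs_le_of_sq_le_sq _ (by positivity)
  have h1 : (q * x - p * y) ^ 2 ≤ (p * p + q * q) * N := by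
    rw [hN']
    nlinarith [sq_nonneg (p * x + q * y)]
  have h2 : (p * p + q * q) * N ≤ s * U * N := mul_le_mul_of_nonneg_right hU hN
  have h3 : s * (U * N) ≤ ((1 + s) / 2) ^ 2 * ((N + U) / 2) ^ 2 := by
    apply mul_le_mul
    · nlinarith [sq_nonneg (1 - s)]
    · nlinarith [sq_nonneg (N - U)]
    · positivity
    · positivity
  calc (q * x - p * y) ^ 2 ≤ s * U * N := h1.trans h2
    _ = s * (U * N) := by ring
    _ ≤ _ := h3
    _ = _ := by ring

theorem energy_le {c : ℝ} (hc : 0 < c) (ξ : E3) (z : Idx → ℂ) :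
    energy c ξ z ≤ 2 * (c + 1) * sizeSq z := by
  have h := (abs_le.1 (abs_energy_coupling_le ξ z)).2
  have hN := Complex.normSq_nonneg (z (Sum.inl ()))
  have hU : 0 ≤ ∑ j : Fin 3, Complex.normSq (z (Sum.inr (Sum.inl j))) :=
    Finset.sum_nonneg fun _ _ => Complex.normSq_nonneg _
  have hV : 0 ≤ ∑ j : Fin 3, Complex.normSq (z (Sum.inr (Sum.inr j))) :=
    Finset.sum_nonneg fun _ _ => Complex.normSq_nonneg _
  have hk : 0 ≤ c / 2 / (1 + ‖ξ‖ ^ 2) := by positivity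
  have h1 := mul_le_mul_of_nonneg_left h hk
  have h2 : c / 2 / (1 + ‖ξ‖ ^ 2) * ((1 + ‖ξ‖ ^ 2) / 4 * (Complex.normSq (z (Sum.inl ()))
        + ∑ j : Fin 3, Complex.normSq (z (Sum.inr (Sum.inl j))))) =
      c / 8 * (Complex.normSq (z (Sum.inl ()))
        + ∑ j : Fin 3, Complex.normSq (z (Sum.inr (Sum.inl j)))) := by
    have : 1 + ‖ξ‖ ^ 2 ≠ 0 := by positivity
    field_simp
    ring
  rw [h2] at h1
  unfold energy sizeSq
  nlinarith [mul_nonneg hc.le hN, mul_nonneg hc.le hU, mul_nonneg hc.le hV]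

theorem le_energy {c : ℝ} (hc : 0 < c) (ξ : E3) (z : Idx → ℂ) :
    min c 1 / 2 * sizeSq z ≤ energy c ξ z := by
  have h := (abs_le.1 (abs_energy_coupling_le ξ z)).1
  have hN := Complex.normSq_nonneg (z (Sum.inl ()))
  have hU : 0 ≤ ∑ j : Fin 3, Complex.normSq (z (Sum.inr (Sum.inl j))) :=
    Finset.sum_nonneg fun _ _ => Complex.normSq_nonneg _
  have hV : 0 ≤ ∑ j : Fin 3, Complex.normSq (z (Sum.inr (Sum.inr j))) :=
    Finset.sum_nonneg fun _ _ => Complex.normSq_nonneg _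
  have hk : 0 ≤ c / 2 / (1 + ‖ξ‖ ^ 2) := by positivity
  have h1 := mul_le_mul_of_nonneg_left h hk
  have h2 : c / 2 / (1 + ‖ξ‖ ^ 2) * -((1 + ‖ξ‖ ^ 2) / 4 * (Complex.normSq (z (Sum.inl ()))
        + ∑ j : Fin 3, Complex.normSq (z (Sum.inr (Sum.inl j))))) =
      -(c / 8 * (Complex.normSq (z (Sum.inl ()))
        + ∑ j : Fin 3, Complex.normSq (z (Sum.inr (Sum.inl j))))) := by
    have : 1 + ‖ξ‖ ^ 2 ≠ 0 := by positivity
    field_simp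
    ring
  rw [h2] at h1
  have hm1 := mul_le_mul_of_nonneg_right (min_le_left c 1) hN
  have hm2 := mul_le_mul_of_nonneg_right (min_le_left c 1) hU
  have hm3 := mul_le_mul_of_nonneg_right (min_le_right c 1) hV
  unfold energy sizeSq
  nlinarith [mul_nonneg hc.le hN, mul_nonneg hc.le hU]

theorem divU_symbolL_mulVec (c : ℝ) (ξ : E3) (z : Idx → ℂ) :
    divU ξ (symbolL c ξ *ᵥ z) =
      Complex.I * ((‖ξ‖ ^ 2 : ℝ) : ℂ) * z (Sum.inl ()) + divU ξ z - divV ξ z := by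
  rw [norm_sq_eq_sum]
  simp only [divU, divV, symbolL_mulVec_inr_inl]
  simp only [Fin.sum_univ_three]
  push_cast
  ring

/-- The weight `c` on `u` turns the friction terms into the perfect square `c|u - v|²`. The pressure
terms cancel by skew-symmetry, and the curl-free projection leaves the cross term between `ξ·u` and
`ξ·v`. The coupling contributes `-|ξ|²|φ|²`, the only damping of `φ`. -/
theorem energyDeriv_neg_symbolL (c : ℝ) (ξ : E3) (z : Idx → ℂ) :
    energyDeriv c ξ z (-(symbolL c ξ *ᵥ z)) =
      -2 * (c * ∑ j : Fin 3, Complex.normSq (z (Sum.inr (Sum.inl j)) - z (Sum.inr (Sum.inr j)))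
        + c * (‖ξ‖ ^ 2)⁻¹ * ((divU ξ z).re * (divV ξ z).re + (divU ξ z).im * (divV ξ z).im)
        + ‖ξ‖ ^ 2 * ∑ j : Fin 3, Complex.normSq (z (Sum.inr (Sum.inr j)))
        - c / 4 / (1 + ‖ξ‖ ^ 2) * (Complex.normSq (divU ξ z)
          - ‖ξ‖ ^ 2 * Complex.normSq (z (Sum.inl ()))
          + ((divV ξ z - divU ξ z).im * (z (Sum.inl ())).re
            - (divV ξ z - divU ξ z).re * (z (Sum.inl ())).im))) := by
  have hneg : divU ξ (-(symbolL c ξ *ᵥ z)) = -divU ξ (symbolL c ξ *ᵥ z) := by simp [divU]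
  have ha : ∑ j : Fin 3, ξ j * (z (Sum.inr (Sum.inl j))).re = (divU ξ z).re := by simp [divU]
  have ha' : ∑ j : Fin 3, ξ j * (z (Sum.inr (Sum.inl j))).im = (divU ξ z).im := by simp [divU]
  have hb : ∑ j : Fin 3, ξ j * (z (Sum.inr (Sum.inr j))).re = (divV ξ z).re := by simp [divV]
  have hb' : ∑ j : Fin 3, ξ j * (z (Sum.inr (Sum.inr j))).im = (divV ξ z).im := by simp [divV]
  unfold energyDeriv
  rw [hneg, divU_symbolL_mulVec]
  simp only [Pi.neg_apply, symbolL_mulVec_inl, symbolL_mulVec_inr_inl, symbolL_mulVec_inr_inr]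
  simp only [Fin.sum_univ_three, Complex.normSq_apply, Complex.neg_re, Complex.neg_im,
    Complex.add_re, Complex.add_im, Complex.sub_re, Complex.sub_im, Complex.mul_re, Complex.mul_im,
    Complex.I_re, Complex.I_im, Complex.ofReal_re, Complex.ofReal_im] at ha ha' hb hb' ⊢
  linear_combination 2 * c * (z (Sum.inl ())).im * ha - 2 * c * (z (Sum.inl ())).re * ha'
    - 2 * c * (‖ξ‖ ^ 2)⁻¹ * (divU ξ z).re * hb - 2 * c * (‖ξ‖ ^ 2)⁻¹ * (divU ξ z).im * hb'

/-- The algebraic core of the dissipation estimate. Here `N, U, V, W` stand for `|φ|²`, `|u|²`,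
`|v|²`, `|u - v|²`, further `A, B, P` for `|ξ·u|²`, `|ξ·v|²`, `Re (ξ·u) conj (ξ·v)`, and `M` for the
coupling of `φ` with `ξ·(v - u)`. -/
theorem dissipation_lower_bound {c s N U V W A B P M : ℝ} (hc : 0 < c) (hs : 0 < s)
    (hN : 0 ≤ N) (hV : 0 ≤ V) (hA : 0 ≤ A) (hB : 0 ≤ B) (hP : 2 * |P| ≤ A + B)
    (hU : U ≤ 2 * W + 2 * V) (hW : A + B - 2 * P ≤ s * W)
    (hM : M ≤ s * N / 2 + (A + B) / s) :
    min c 1 / 16 * (s / (1 + s)) * (N + U + V) ≤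
      c * W + c * s⁻¹ * P + s * V - c / 4 / (1 + s) * (A - s * N + M) := by
  have hs1 : 0 < 1 + s := by linarith
  obtain ⟨A', rfl⟩ : ∃ A', A = s * A' := ⟨A / s, by field_simp⟩
  obtain ⟨B', rfl⟩ : ∃ B', B = s * B' := ⟨B / s, by field_simp⟩
  obtain ⟨P', rfl⟩ : ∃ P', P = s * P' := ⟨P / s, by field_simp⟩
  have hA' : 0 ≤ A' := nonneg_of_mul_nonneg_right hA hs
  have hB' : 0 ≤ B' := nonneg_of_mul_nonneg_right hB hs
  rw [abs_mul, abs_of_pos hs] at hP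
  have hP1 : 2 * |P'| ≤ A' + B' := by
    apply le_of_mul_le_mul_left _ hs
    linarith
  have hPu : 2 * P' ≤ A' + B' := by linarith [le_abs_self P']
  have hPl : -(A' + B') ≤ 2 * P' := by linarith [neg_abs_le P']
  -- `A', B', P'` are the longitudinal parts of `|u|²`, `|v|²` and of their product, and `X` is the
  -- transverse part of `|u - v|²`. The sign of `P'` is unknown, but friction and cross term
  -- together give `c(A' + B' - P') ≥ c(A' + B')/2`.
  have hX : 0 ≤ W - (A' + B' - 2 * P') := by
    have : s * (A' + B' - 2 * P') ≤ s * W := by linarith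
    linarith [le_of_mul_le_mul_left this hs]
  obtain ⟨X, hXd⟩ : ∃ X, X = W - (A' + B' - 2 * P') := ⟨_, rfl⟩
  rw [← hXd] at hX
  obtain rfl : W = X + (A' + B' - 2 * P') := by linarith
  have hM' : M ≤ s * N / 2 + (A' + B') := by
    have : (s * A' + s * B') / s = A' + B' := by field_simp
    linarith
  obtain ⟨ρ, hρ⟩ : ∃ ρ, ρ = s / (1 + s) := ⟨_, rfl⟩
  have hρ0 : 0 ≤ ρ := by rw [hρ]; positivity
  have hρ1 : ρ ≤ 1 := by rw [hρ, div_le_one hs1]; linarith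
  have hρs : ρ ≤ s := by rw [hρ, div_le_iff₀ hs1]; nlinarith
  rw [← hρ]
  have hc1 : c * s⁻¹ * (s * P') = c * P' := by field_simp
  -- At most `c(A' + B')/4` is lost to the coupling, half of what friction supplies, and a damping
  -- `c ρ N / 8` of `φ` is gained.
  have hcoup : c / 4 / (1 + s) * (s * A' - s * N + M) ≤ c / 4 * (A' + B') - c / 8 * ρ * N := by
    have h1 : c / 4 / (1 + s) * (s * A' - s * N + M) ≤
        c / 4 / (1 + s) * ((1 + s) * (A' + B') - s * N / 2) := by
      apply mul_le_mul_of_nonneg_left _ (by positivity)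
      nlinarith [mul_nonneg hs.le hB']
    refine h1.trans_eq ?_
    rw [hρ]
    field_simp
    ring
  rw [hc1]
  have hm : 0 < min c 1 := lt_min hc one_pos
  have hmc : min c 1 ≤ c := min_le_left c 1
  have hm1 : min c 1 ≤ 1 := min_le_right c 1
  obtain ⟨m, hmd⟩ : ∃ m, m = min c 1 := ⟨_, rfl⟩
  rw [← hmd] at hm hmc hm1 ⊢
  have hmρ : m * ρ ≤ c := by nlinarith
  have hmρs : m * ρ ≤ s := by nlinarith
  have hmρ0 : 0 ≤ m * ρ := by positivity
  have hUle : N + U + V ≤ N + 2 * X + 4 * (A' + B') + 3 * V := by linarith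
  have g1 : m / 16 * ρ * (N + U + V) ≤ m / 16 * ρ * (N + 2 * X + 4 * (A' + B') + 3 * V) :=
    mul_le_mul_of_nonneg_left hUle (by positivity)
  have g2 : m * ρ * N ≤ c * ρ * N :=
    mul_le_mul_of_nonneg_right (mul_le_mul_of_nonneg_right hmc hρ0) hN
  have g3 : m * ρ * X ≤ c * X := mul_le_mul_of_nonneg_right hmρ hX
  have g4 : m * ρ * (A' + B') ≤ c * (A' + B') :=
    mul_le_mul_of_nonneg_right hmρ (add_nonneg hA' hB')
  have g5 : m * ρ * V ≤ s * V := mul_le_mul_of_nonneg_right hmρs hV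
  have g6 : c * P' ≤ c * ((A' + B') / 2) := mul_le_mul_of_nonneg_left (by linarith) hc.le
  have g7 : 0 ≤ c * ρ * N := by positivity
  have g8 : 0 ≤ c * (A' + B') := by positivity
  -- The factor `1/16` is set by `A' + B'`: its coefficient on the left is `4/16` times `m ρ`, and
  -- exactly `c/4` is available on the right.
  nlinarith [mul_nonneg hc.le hX, mul_nonneg hs.le hV]

/-- The dissipation rate `|ξ|² / (1 + |ξ|²)`: heat-like at low and uniform at high frequencies. -/
def rate (ξ : E3) : ℝ := ‖ξ‖ ^ 2 / (1 + ‖ξ‖ ^ 2)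

theorem rate_nonneg (ξ : E3) : 0 ≤ rate ξ := by unfold rate; positivity

theorem energyDeriv_le {c : ℝ} (hc : 0 < c) {ξ : E3} (hξ : ξ ≠ 0) (z : Idx → ℂ) :
    energyDeriv c ξ z (-(symbolL c ξ *ᵥ z)) ≤ -(min c 1 / 8 * rate ξ * sizeSq z) := by
  have hs : 0 < ‖ξ‖ ^ 2 := by positivity
  rw [energyDeriv_neg_symbolL]
  have hdiff : divU ξ z - divV ξ z =
      ∑ j : Fin 3, (ξ j : ℂ) * (z (Sum.inr (Sum.inl j)) - z (Sum.inr (Sum.inr j))) := by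
    simp only [divU, divV, ← Finset.sum_sub_distrib, mul_sub]
  have hW := normSq_sum_real_mul_le ξ
    (fun j => z (Sum.inr (Sum.inl j)) - z (Sum.inr (Sum.inr j)))
  rw [← hdiff] at hW
  have hU : ∑ j : Fin 3, Complex.normSq (z (Sum.inr (Sum.inl j))) ≤
      2 * (∑ j : Fin 3, Complex.normSq (z (Sum.inr (Sum.inl j)) - z (Sum.inr (Sum.inr j))))
        + 2 * ∑ j : Fin 3, Complex.normSq (z (Sum.inr (Sum.inr j))) := by
    rw [Finset.mul_sum, Finset.mul_sum, ← Finset.sum_add_distrib]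
    refine Finset.sum_le_sum fun j _ => ?_
    simp only [Complex.normSq_apply, Complex.sub_re, Complex.sub_im]
    nlinarith [sq_nonneg ((z (Sum.inr (Sum.inl j))).re - 2 * (z (Sum.inr (Sum.inr j))).re),
      sq_nonneg ((z (Sum.inr (Sum.inl j))).im - 2 * (z (Sum.inr (Sum.inr j))).im)]
  have key := dissipation_lower_bound (N := Complex.normSq (z (Sum.inl ())))
    (V := ∑ j : Fin 3, Complex.normSq (z (Sum.inr (Sum.inr j))))
    (A := Complex.normSq (divU ξ z)) (B := Complex.normSq (divV ξ z))
    (P := (divU ξ z).re * (divV ξ z).re + (divU ξ z).im * (divV ξ z).im)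
    (M := (divV ξ z - divU ξ z).im * (z (Sum.inl ())).re
            - (divV ξ z - divU ξ z).re * (z (Sum.inl ())).im)
    hc hs (Complex.normSq_nonneg _) (Finset.sum_nonneg fun _ _ => Complex.normSq_nonneg _)
    (Complex.normSq_nonneg _) (Complex.normSq_nonneg _) ?_ hU ?_ ?_
  · unfold rate sizeSq
    linarith
  · simp only [Complex.normSq_apply]
    have : ∀ x y : ℝ, 0 ≤ y - 2 * x → 0 ≤ y + 2 * x → 2 * |x| ≤ y := by
      intro x y h1 h2
      rcases abs_cases x with ⟨h, _⟩ | ⟨h, _⟩ <;> rw [h] <;> linarith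
    apply this
    · nlinarith [sq_nonneg ((divU ξ z).re - (divV ξ z).re),
        sq_nonneg ((divU ξ z).im - (divV ξ z).im)]
    · nlinarith [sq_nonneg ((divU ξ z).re + (divV ξ z).re),
        sq_nonneg ((divU ξ z).im + (divV ξ z).im)]
  · refine le_trans (le_of_eq ?_) hW
    simp only [Complex.normSq_apply, Complex.sub_re, Complex.sub_im]
    ring
  · simp only [Complex.normSq_apply, Complex.sub_re, Complex.sub_im]
    set s := ‖ξ‖ ^ 2
    -- Young's inequality is weighted to spend only half of the damping `s |φ|²`.
    have e : ∀ a b x : ℝ, (a - b) * x ≤ s * (x * x) / 2 + (a * a + b * b) / s := by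
      intro a b x
      rw [← sub_nonneg]
      have : s * (x * x) / 2 + (a * a + b * b) / s - (a - b) * x
          = ((s * x - (a - b)) ^ 2 + (a + b) ^ 2) / (2 * s) := by
        field_simp
        ring
      rw [this]
      positivity
    have e1 := e (divV ξ z).im (divU ξ z).im (z (Sum.inl ())).re
    have e2 := e (divU ξ z).re (divV ξ z).re (z (Sum.inl ())).im
    have e3 : ((divU ξ z).re * (divU ξ z).re + (divU ξ z).im * (divU ξ z).im
        + ((divV ξ z).re * (divV ξ z).re + (divV ξ z).im * (divV ξ z).im)) / s
        = ((divV ξ z).im * (divV ξ z).im + (divU ξ z).im * (divU ξ z).im) / s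
        + ((divU ξ z).re * (divU ξ z).re + (divV ξ z).re * (divV ξ z).re) / s := by
      ring
    rw [e3]
    linarith

/-- The exponential decay rate of the Green function, up to the factor `rate ξ`. -/
def decayConst (c : ℝ) : ℝ := min c 1 / (32 * (c + 1))

theorem decayConst_pos {c : ℝ} (hc : 0 < c) : 0 < decayConst c := by
  have : 0 < min c 1 := lt_min hc one_pos
  unfold decayConst
  positivity

/-- Grönwall by an integrating factor: the energy times `exp (κ s)` is nonincreasing. -/
theorem energy_greenExp_le {c : ℝ} (hc : 0 < c) {ξ : E3} (hξ : ξ ≠ 0) {t : ℝ} (ht : 0 ≤ t)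
    (z : Idx → ℂ) :
    energy c ξ (greenExp c t ξ *ᵥ z) ≤
      Real.exp (-(2 * decayConst c * rate ξ * t)) * energy c ξ z := by
  set κ := 2 * decayConst c * rate ξ with hκ
  let Z : ℝ → Idx → ℂ := fun s => greenExp c s ξ *ᵥ z
  have hZ : ∀ s, HasDerivAt Z (-(symbolL c ξ *ᵥ Z s)) s := fun s =>
    hasDerivAt_matrix_exp_mulVec (symbolL c ξ) z s
  have hF : ∀ s, HasDerivAt (fun s => Real.exp (κ * s) * energy c ξ (Z s))
      (Real.exp (κ * s) * κ * energy c ξ (Z s)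
        + Real.exp (κ * s) * energyDeriv c ξ (Z s) (-(symbolL c ξ *ᵥ Z s))) s := by
    intro s
    have h1 : HasDerivAt (fun s : ℝ => Real.exp (κ * s)) (Real.exp (κ * s) * κ) s := by
      simpa using ((hasDerivAt_id s).const_mul κ).exp
    exact h1.mul (hasDerivAt_energy c ξ (hZ s))
  have hanti : Antitone fun s => Real.exp (κ * s) * energy c ξ (Z s) := by
    apply antitone_of_deriv_nonpos (fun s => (hF s).differentiableAt)
    intro s
    rw [(hF s).deriv]
    have h1 := energyDeriv_le hc hξ (Z s)
    have h2 := energy_le hc ξ (Z s)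
    have hκ0 : 0 ≤ κ := mul_nonneg (by linarith [decayConst_pos hc]) (rate_nonneg ξ)
    -- This fixes `decayConst`: dissipation `min c 1 / 8` over the upper energy constant `2(c + 1)`
    -- is `2 * decayConst c`. The factor two disappears on passing from the energy to the norm.
    have h3 : κ * energy c ξ (Z s) ≤ min c 1 / 8 * rate ξ * sizeSq (Z s) := by
      refine (mul_le_mul_of_nonneg_left h2 hκ0).trans_eq ?_
      rw [hκ, decayConst]
      field_simp
      ring
    have h4 : κ * energy c ξ (Z s) + energyDeriv c ξ (Z s) (-(symbolL c ξ *ᵥ Z s)) ≤ 0 := by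
      linarith
    calc _ = Real.exp (κ * s) *
          (κ * energy c ξ (Z s) + energyDeriv c ξ (Z s) (-(symbolL c ξ *ᵥ Z s))) := by ring
      _ ≤ 0 := mul_nonpos_of_nonneg_of_nonpos (Real.exp_pos _).le h4
  have h0 : Z 0 = z := by simp [Z, greenExp]
  have h := hanti ht
  simp only [mul_zero, Real.exp_zero, one_mul, h0] at h
  calc energy c ξ (Z t) = Real.exp (-(κ * t)) * (Real.exp (κ * t) * energy c ξ (Z t)) := by
        rw [← mul_assoc, ← Real.exp_add]; simp
    _ ≤ _ := mul_le_mul_of_nonneg_left h (Real.exp_pos _).le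

theorem norm_sq_eq_sizeSq (z : St) : ‖z‖ ^ 2 = sizeSq z := by
  rw [EuclideanSpace.norm_sq_eq]
  simp [Fintype.sum_sum_type, sizeSq, Complex.normSq_eq_norm_sq, add_assoc]

theorem norm_greenExp_apply_le {c : ℝ} (hc : 0 < c) {ξ : E3} (hξ : ξ ≠ 0) {t : ℝ} (ht : 0 ≤ t)
    (z : St) :
    ‖Matrix.toEuclideanLin (greenExp c t ξ) z‖ ≤
      2 * (c + 1) / min c 1 * Real.exp (-(decayConst c * rate ξ * t)) * ‖z‖ := by
  have hm : 0 < min c 1 := lt_min hc one_pos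
  have hm1 : min c 1 ≤ 1 := min_le_right c 1
  apply le_of_sq_le_sq _ (by positivity)
  have h1 := energy_greenExp_le hc hξ ht z.ofLp
  have h2 := le_energy hc ξ (greenExp c t ξ *ᵥ z.ofLp)
  have h3 := energy_le hc ξ z.ofLp
  have hexp : Real.exp (-(2 * decayConst c * rate ξ * t))
      = Real.exp (-(decayConst c * rate ξ * t)) ^ 2 := by
    rw [← Real.exp_nat_mul]
    congr 1
    push_cast
    ring
  rw [hexp] at h1
  set e := Real.exp (-(decayConst c * rate ξ * t))
  have h4 : min c 1 / 2 * sizeSq (greenExp c t ξ *ᵥ z.ofLp) ≤ e ^ 2 * (2 * (c + 1) * sizeSq z.ofLp) :=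
    h2.trans (h1.trans (mul_le_mul_of_nonneg_left h3 (sq_nonneg e)))
  have h5 : ‖Matrix.toEuclideanLin (greenExp c t ξ) z‖ ^ 2 = sizeSq (greenExp c t ξ *ᵥ z.ofLp) :=
    norm_sq_eq_sizeSq _
  rw [h5, mul_pow, norm_sq_eq_sizeSq]
  have h6 : sizeSq (greenExp c t ξ *ᵥ z.ofLp) ≤
      4 * (c + 1) / min c 1 * (e ^ 2 * sizeSq z.ofLp) := by
    rw [div_mul_eq_mul_div, le_div_iff₀ hm]
    linarith
  refine h6.trans ?_
  -- Replacing the constant by a larger perfect square, possible since `min c 1 ≤ 1 ≤ c + 1`, avoids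
  -- a square root in the final bound.
  have h7 : 4 * (c + 1) / min c 1 ≤ (2 * (c + 1) / min c 1) ^ 2 := by
    rw [div_pow, div_le_div_iff₀ hm (by positivity)]
    have : min c 1 * min c 1 ≤ min c 1 * (c + 1) :=
      mul_le_mul_of_nonneg_left (by linarith) hm.le
    nlinarith
  calc _ ≤ (2 * (c + 1) / min c 1) ^ 2 * (e ^ 2 * sizeSq z.ofLp) :=
        mul_le_mul_of_nonneg_right h7 (mul_nonneg (sq_nonneg _) (sizeSq_nonneg _))
    _ = _ := by ring

/-! ### The explicit Green matrix on curl-free `v` -/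

/-- The state `(0, 0, y)`. -/
def vState (y : Fin 3 → ℂ) : Idx → ℂ := Sum.elim (fun _ => 0) (Sum.elim (fun _ => 0) y)

theorem sizeSq_vState (y : Fin 3 → ℂ) : sizeSq (vState y) = ∑ j, Complex.normSq (y j) := by
  simp [sizeSq, vState]

/-- The blocks acting on `v` are scalar multiples of the identity, so the factor does not depend on
the direction of `y`. -/
theorem exists_sizeSq_greenFormula_vState (c t : ℝ) (ξ : E3) :
    ∃ g : ℝ, ∀ y : Fin 3 → ℂ,
      sizeSq (greenFormula c t ξ *ᵥ vState y) = g * sizeSq (vState y) := by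
  refine ⟨Complex.normSq ((Complex.exp (eig₃ c ξ * t) - Complex.exp (eig₄ c ξ * t)) /
      (eig₃ c ξ - eig₄ c ξ)) + Complex.normSq (((eig₃ c ξ + 1) * Complex.exp (eig₃ c ξ * t)
        - (eig₄ c ξ + 1) * Complex.exp (eig₄ c ξ * t)) / (eig₃ c ξ - eig₄ c ξ)), fun y => ?_⟩
  have hd : divU ξ (vState y) = 0 := by simp [divU, vState]
  rw [sizeSq_vState, sizeSq]
  simp only [greenFormula_mulVec_inl, greenFormula_mulVec_inr_inl, greenFormula_mulVec_inr_inr, hd]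
  simp only [vState, Sum.elim_inl, Sum.elim_inr, mul_zero, sub_zero, add_zero, zero_add, map_zero,
    Complex.normSq_mul, ← Finset.mul_sum]
  ring

theorem exists_transverse (ξ : E3) :
    ∃ y : Fin 3 → ℂ, ∑ j, (ξ j : ℂ) * y j = 0 ∧ 0 < ∑ j, Complex.normSq (y j) := by
  by_cases h : ξ 0 = 0 ∧ ξ 1 = 0
  · exact ⟨![1, 0, 0], by simp [Fin.sum_univ_three, h.1], by simp [Fin.sum_univ_three]⟩
  · refine ⟨![-(ξ 1 : ℂ), (ξ 0 : ℂ), 0], by simp [Fin.sum_univ_three]; ring, ?_⟩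
    simp only [Fin.sum_univ_three, Matrix.cons_val_zero, Matrix.cons_val_one, Matrix.cons_val,
      Complex.normSq_neg, Complex.normSq_ofReal, map_zero, add_zero]
    rcases not_and_or.1 h with h | h
    · nlinarith [mul_self_pos.2 h, mul_self_nonneg (ξ 1)]
    · nlinarith [mul_self_pos.2 h, mul_self_nonneg (ξ 0)]

theorem norm_toEuclideanLin_sq (M : Matrix Idx Idx ℂ) (z : St) :
    ‖Matrix.toEuclideanLin M z‖ ^ 2 = sizeSq (M *ᵥ z.ofLp) :=
  norm_sq_eq_sizeSq _

/-- The direction-independent factor is measured on a transverse `η ≠ 0`, where the formula agrees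
with the exponential and the energy bound applies. It then serves every `y`, including those
parallel to `ξ`. -/
theorem norm_greenFormula_vState_le {c : ℝ} (hc : 0 < c) {ξ : E3} (hξ : ξ ≠ 0)
    (hξ' : ‖ξ‖ ≠ 1 / 2) {t : ℝ} (ht : 0 ≤ t) (y : Fin 3 → ℂ) :
    ‖Matrix.toEuclideanLin (greenFormula c t ξ) (WithLp.toLp 2 (vState y))‖ ≤
      2 * (c + 1) / min c 1 * Real.exp (-(decayConst c * rate ξ * t))
        * ‖(WithLp.toLp 2 (vState y) : St)‖ := by
  have hm : 0 < min c 1 := lt_min hc one_pos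
  set K := 2 * (c + 1) / min c 1 * Real.exp (-(decayConst c * rate ξ * t)) with hK
  have hK0 : 0 ≤ K := by positivity
  obtain ⟨g, hg⟩ := exists_sizeSq_greenFormula_vState c t ξ
  obtain ⟨η, hη, hη0⟩ := exists_transverse ξ
  have h1 := norm_greenExp_apply_le hc hξ ht (WithLp.toLp 2 (vState η))
  rw [← hK] at h1
  have h2 := pow_le_pow_left₀ (norm_nonneg _) h1 2
  rw [mul_pow, norm_toEuclideanLin_sq, norm_sq_eq_sizeSq] at h2
  have hdiv : divV ξ (vState η) = 0 := by simpa [divV, vState] using hη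
  simp only [← greenFormula_mulVec_eq_greenExp_mulVec hc t hξ hξ' _ hdiv, hg] at h2
  rw [sizeSq_vState] at h2
  have hgK : g ≤ K ^ 2 := le_of_mul_le_mul_right h2 hη0
  apply le_of_sq_le_sq _ (by positivity)
  rw [mul_pow, norm_toEuclideanLin_sq, norm_sq_eq_sizeSq]
  simp only [hg]
  exact mul_le_mul_of_nonneg_right hgK (sizeSq_nonneg _)

/-- The constant in front of the exponential bound of both Green matrices. -/
def growthConst (c : ℝ) : ℝ := 6 * (c + 1) / min c 1

theorem growthConst_pos {c : ℝ} (hc : 0 < c) : 0 < growthConst c := by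
  have : 0 < min c 1 := lt_min hc one_pos
  unfold growthConst
  positivity

theorem norm_greenFormula_apply_le {c : ℝ} (hc : 0 < c) {ξ : E3} (hξ : ξ ≠ 0)
    (hξ' : ‖ξ‖ ≠ 1 / 2) {t : ℝ} (ht : 0 ≤ t) (z : St) :
    ‖Matrix.toEuclideanLin (greenFormula c t ξ) z‖ ≤
      growthConst c * Real.exp (-(decayConst c * rate ξ * t)) * ‖z‖ := by
  have hm : 0 < min c 1 := lt_min hc one_pos
  have hs : 0 < ‖ξ‖ ^ 2 := by positivity
  have hsC : (‖ξ‖ : ℂ) ≠ 0 := by simpa using hξ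
  have hs2 : ∑ j : Fin 3, (ξ j : ℂ) ^ 2 = (‖ξ‖ : ℂ) ^ 2 := by
    exact_mod_cast congrArg (Complex.ofReal) (norm_sq_eq_sum ξ).symm
  -- `y` is the projection of `v` onto `ξ`; removing it leaves a state on which both matrices agree.
  -- The bounds `2‖z‖` and `‖z‖` for the two pieces account for the factor three in `growthConst`.
  let y : Fin 3 → ℂ := fun j => ξ j * ((((‖ξ‖ ^ 2)⁻¹ : ℝ) : ℂ) * divV ξ z)
  let zL : St := WithLp.toLp 2 (vState y)
  have hzL : ‖zL‖ ≤ ‖z‖ := by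
    apply le_of_sq_le_sq _ (norm_nonneg _)
    rw [norm_sq_eq_sizeSq, norm_sq_eq_sizeSq]
    change sizeSq (vState y) ≤ _
    rw [sizeSq_vState]
    have h1 : ∑ j, Complex.normSq (y j) = (‖ξ‖ ^ 2)⁻¹ * Complex.normSq (divV ξ z) := by
      simp only [y, Complex.normSq_mul, Complex.normSq_ofReal, ← Finset.sum_mul, ← pow_two]
      rw [← norm_sq_eq_sum]
      field_simp
    have h2 := normSq_sum_real_mul_le ξ (fun j => z (Sum.inr (Sum.inr j)))
    rw [h1, inv_mul_le_iff₀ hs]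
    refine h2.trans (mul_le_mul_of_nonneg_left ?_ hs.le)
    unfold sizeSq
    have hN := Complex.normSq_nonneg (z (Sum.inl ()))
    have hU : 0 ≤ ∑ j : Fin 3, Complex.normSq (z (Sum.inr (Sum.inl j))) :=
      Finset.sum_nonneg fun _ _ => Complex.normSq_nonneg _
    linarith
  have hdiv : divV ξ (z - zL).ofLp = 0 := by
    have h1 : divV ξ (z - zL).ofLp = divV ξ z - ∑ j, (ξ j : ℂ) * y j := by
      simp only [divV, ← Finset.sum_sub_distrib]
      refine Finset.sum_congr rfl fun j _ => ?_
      simp [zL, vState]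
      ring
    have h2 : ∀ j, (ξ j : ℂ) * y j = (ξ j : ℂ) ^ 2 * ((((‖ξ‖ ^ 2)⁻¹ : ℝ) : ℂ) * divV ξ z) :=
      fun j => by simp only [y]; ring
    rw [h1]
    simp only [h2, ← Finset.sum_mul, hs2]
    push_cast
    field_simp
    ring
  have hT : Matrix.toEuclideanLin (greenFormula c t ξ) (z - zL)
      = Matrix.toEuclideanLin (greenExp c t ξ) (z - zL) :=
    congrArg (WithLp.toLp 2) (greenFormula_mulVec_eq_greenExp_mulVec hc t hξ hξ' _ hdiv)
  have hsplit : Matrix.toEuclideanLin (greenFormula c t ξ) z =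
      Matrix.toEuclideanLin (greenExp c t ξ) (z - zL)
        + Matrix.toEuclideanLin (greenFormula c t ξ) zL := by
    rw [← hT, ← map_add, sub_add_cancel]
  have b1 := norm_greenExp_apply_le hc hξ ht (z - zL)
  have b2 := norm_greenFormula_vState_le hc hξ hξ' ht y
  have b3 : ‖z - zL‖ ≤ 2 * ‖z‖ := (norm_sub_le _ _).trans (by linarith)
  set K := 2 * (c + 1) / min c 1 * Real.exp (-(decayConst c * rate ξ * t)) with hK
  have hK0 : 0 ≤ K := by positivity
  have hKG : growthConst c * Real.exp (-(decayConst c * rate ξ * t)) = 3 * K := by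
    rw [hK, growthConst]; ring
  rw [hsplit, hKG]
  refine (norm_add_le _ _).trans ?_
  have b4 := mul_le_mul_of_nonneg_left b3 hK0
  have b5 := mul_le_mul_of_nonneg_left hzL hK0
  change ‖Matrix.toEuclideanLin (greenFormula c t ξ) zL‖ ≤ K * ‖zL‖ at b2
  linarith

/-- Both Green matrices obey the same pointwise bound. -/
theorem norm_green_apply_le {c : ℝ} (hc : 0 < c) {G : ℝ → E3 → Matrix Idx Idx ℂ}
    (hG : G ∈ ({greenFormula c, greenExp c} : Set (ℝ → E3 → Matrix Idx Idx ℂ)))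
    {ξ : E3} (hξ : ξ ≠ 0) (hξ' : ‖ξ‖ ≠ 1 / 2) {t : ℝ} (ht : 0 ≤ t) (z : St) :
    ‖Matrix.toEuclideanLin (G t ξ) z‖ ≤
      growthConst c * Real.exp (-(decayConst c * rate ξ * t)) * ‖z‖ := by
  rcases hG with rfl | rfl
  · exact norm_greenFormula_apply_le hc hξ hξ' ht z
  · refine (norm_greenExp_apply_le hc hξ ht z).trans ?_
    have hm : 0 < min c 1 := lt_min hc one_pos
    apply mul_le_mul_of_nonneg_right _ (norm_nonneg _)
    apply mul_le_mul_of_nonneg_right _ (Real.exp_pos _).le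
    unfold growthConst
    apply div_le_div_of_nonneg_right _ hm.le
    linarith

/-! ### Measurability of the symbols -/

theorem measurable_coord (j : Fin 3) : Measurable fun ξ : E3 => ξ j :=
  (EuclideanSpace.proj (𝕜 := ℝ) j).continuous.measurable

theorem measurable_projCurlFree (i j : Fin 3) : Measurable fun ξ : E3 => projCurlFree ξ i j := by
  simp only [projCurlFree, Matrix.smul_apply, Matrix.vecMulVec_apply, cvec, smul_eq_mul]
  have := measurable_coord i
  have := measurable_coord j
  fun_prop

theorem measurable_projDivFree (i j : Fin 3) : Measurable fun ξ : E3 => projDivFree ξ i j := by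
  simp only [projDivFree, Matrix.sub_apply]
  exact measurable_const.sub (measurable_projCurlFree i j)

theorem measurable_block_apply {a₁₁ : E3 → ℂ} {a₁₂ a₁₃ a₂₁ a₃₁ : E3 → Fin 3 → ℂ}
    {a₂₂ a₂₃ a₃₂ a₃₃ : E3 → Matrix (Fin 3) (Fin 3) ℂ} (h₁₁ : Measurable a₁₁)
    (h₁₂ : ∀ j, Measurable fun ξ => a₁₂ ξ j) (h₁₃ : ∀ j, Measurable fun ξ => a₁₃ ξ j)
    (h₂₁ : ∀ j, Measurable fun ξ => a₂₁ ξ j) (h₂₂ : ∀ i j, Measurable fun ξ => a₂₂ ξ i j)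
    (h₂₃ : ∀ i j, Measurable fun ξ => a₂₃ ξ i j) (h₃₁ : ∀ j, Measurable fun ξ => a₃₁ ξ j)
    (h₃₂ : ∀ i j, Measurable fun ξ => a₃₂ ξ i j) (h₃₃ : ∀ i j, Measurable fun ξ => a₃₃ ξ i j)
    (i j : Idx) :
    Measurable fun ξ => block (a₁₁ ξ) (a₁₂ ξ) (a₁₃ ξ) (a₂₁ ξ) (a₂₂ ξ) (a₂₃ ξ) (a₃₁ ξ) (a₃₂ ξ)
      (a₃₃ ξ) i j := by
  rcases i with i | i | i <;> rcases j with j | j | j <;> simp only [block]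
  exacts [h₁₁, h₁₂ j, h₁₃ j, h₂₁ i, h₂₂ i j, h₂₃ i j, h₃₁ i, h₃₂ i j, h₃₃ i j]

theorem measurable_symbolL (c : ℝ) (i j : Idx) : Measurable fun ξ : E3 => symbolL c ξ i j := by
  have := measurable_coord
  have hI : ∀ j, Measurable fun ξ : E3 => (Complex.I • cvec ξ) j := fun j => by
    simp only [Pi.smul_apply, cvec]
    fun_prop
  unfold symbolL
  apply measurable_block_apply
  · exact measurable_const
  · exact hI
  · exact fun _ => measurable_const
  · exact hI
  · exact fun _ _ => measurable_const
  · exact fun _ _ => measurable_const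
  · exact fun _ => measurable_const
  · exact fun i j => ((measurable_projDivFree i j).const_mul (c : ℂ)).neg
  · exact fun i j => Measurable.mul_const (by fun_prop) _

theorem measurable_greenExp (c t : ℝ) (i j : Idx) :
    Measurable fun ξ : E3 => greenExp c t ξ i j := by
  -- Matrices are read as functions of two indices, so that measurability can be checked entry by
  -- entry in the product σ-algebra.
  have h1 : Continuous fun M : Idx → Idx → ℂ =>
      NormedSpace.exp (-((t : ℂ) • Matrix.of M)) i j := by
    have h : Continuous fun M : Matrix Idx Idx ℂ => -((t : ℂ) • M) :=
      (continuous_id.const_smul (t : ℂ)).neg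
    exact (continuous_matrix_exp.comp h).matrix_elem i j
  have h2 : Measurable fun (ξ : E3) (i j : Idx) => symbolL c ξ i j :=
    measurable_pi_lambda _ fun i => measurable_pi_lambda _ fun j => measurable_symbolL c i j
  exact h1.measurable.comp h2

theorem measurable_greenFormula (c t : ℝ) (i j : Idx) :
    Measurable fun ξ : E3 => greenFormula c t ξ i j := by
  have := measurable_coord
  have d₁ : Measurable fun ξ : E3 => disc₁ ξ := by unfold disc₁; fun_prop
  have d₂ : Measurable fun ξ : E3 => disc₂ c ξ := by unfold disc₂; fun_prop
  have e₁ : Measurable fun ξ : E3 => eig₁ ξ := by unfold eig₁; fun_prop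
  have e₂ : Measurable fun ξ : E3 => eig₂ ξ := by unfold eig₂; fun_prop
  have e₃ : Measurable fun ξ : E3 => eig₃ c ξ := by unfold eig₃; fun_prop
  have e₄ : Measurable fun ξ : E3 => eig₄ c ξ := by unfold eig₄; fun_prop
  have hI : ∀ j, Measurable fun ξ : E3 => (-((Complex.exp (eig₁ ξ * t) - Complex.exp (eig₂ ξ * t)) /
      (eig₁ ξ - eig₂ ξ) * Complex.I) • cvec ξ) j := fun j => by
    simp only [Pi.smul_apply, cvec, smul_eq_mul]
    fun_prop
  unfold greenFormula
  refine measurable_block_apply ?_ hI (fun _ => measurable_const) hI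
    (fun i j => (Measurable.mul ?_ (measurable_projDivFree i j)).add
      (Measurable.mul ?_ (measurable_projCurlFree i j)))
    (fun i j => Measurable.mul_const ?_ _) (fun _ => measurable_const)
    (fun i j => Measurable.mul ?_ (measurable_projDivFree i j))
    (fun i j => Measurable.mul_const ?_ _) i j <;> fun_prop

theorem measurable_green {c : ℝ} {G : ℝ → E3 → Matrix Idx Idx ℂ}
    (hG : G ∈ ({greenFormula c, greenExp c} : Set (ℝ → E3 → Matrix Idx Idx ℂ))) (t : ℝ)
    (i j : Idx) : Measurable fun ξ : E3 => G t ξ i j := by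
  rcases hG with rfl | rfl
  · exact measurable_greenFormula c t i j
  · exact measurable_greenExp c t i j

theorem measurable_toEuclideanLin_apply {m : E3 → Matrix Idx Idx ℂ}
    (hm : ∀ i j, Measurable fun ξ => m ξ i j) {h : E3 → St} (hh : Measurable h) :
    Measurable fun w => Matrix.toEuclideanLin (m w) (h w) := by
  have h1 : Measurable fun w => (m w *ᵥ (h w).ofLp) := by
    refine measurable_pi_lambda _ fun i => ?_
    simp only [Matrix.mulVec, dotProduct]
    refine Finset.measurable_sum _ fun j _ => (hm i j).mul ?_
    exact (EuclideanSpace.proj (𝕜 := ℂ) j).continuous.measurable.comp hh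
  exact (PiLp.continuous_toLp 2 _).measurable.comp h1

/-! ### Tempered distributions whose Fourier transform is a function -/

/-- The Fourier transform of `T` is the function `h`. -/
def HasFourierFunction (T : 𝓢'(E3, St)) (h : E3 → St) : Prop :=
  ∀ g : 𝓢(E3, ℂ), Integrable (fun w : E3 => g w • h w) ∧ (𝓕 T) g = ∫ w : E3, g w • h w

theorem continuous_fourier_coe (f : Lp St 1 (volume : Measure E3)) :
    Continuous (𝓕 (f : E3 → St)) :=
  (Real.Lp.fourierTransform f).continuous

theorem norm_fourier_coe_le (f : Lp St 1 (volume : Measure E3)) (w : E3) :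
    ‖𝓕 (f : E3 → St) w‖ ≤ ‖f‖ := by
  rw [Real.fourier_eq]
  apply (norm_integral_le_integral_norm _).trans
  simp_rw [Circle.norm_smul]
  exact (L1.norm_eq_integral_norm f).symm.le

theorem integrable_schwartz_smul_Lp_top (g : 𝓢(E3, ℂ)) {h : E3 → St} {C : ℝ}
    (hm : AEStronglyMeasurable h volume) (hC : ∀ᵐ w, ‖h w‖ ≤ C) :
    Integrable fun w => g w • h w :=
  g.integrable.smul_bdd C hm hC

/-- This is the symmetry `∫ ĝ f = ∫ g f̂`, which reconciles the integral and the distributional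
transforms. -/
theorem hasFourierFunction_L1 (f : Lp St 1 (volume : Measure E3)) :
    HasFourierFunction (f : 𝓢'(E3, St)) (𝓕 (f : E3 → St)) := by
  intro g
  refine ⟨integrable_schwartz_smul_Lp_top g (continuous_fourier_coe f).aestronglyMeasurable
    (Filter.Eventually.of_forall (norm_fourier_coe_le f)), ?_⟩
  rw [TemperedDistribution.fourier_apply, Lp.toTemperedDistribution_apply]
  have h := VectorFourier.integral_fourierIntegral_smul_eq_flip (L := innerₗ E3)
    (f := (g : E3 → ℂ)) (g := (f : E3 → St)) (μ := volume) (ν := volume)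
    Real.continuous_fourierChar continuous_inner g.integrable (L1.integrable_coeFn f)
  rw [flip_innerₗ] at h
  exact h

theorem hasFourierFunction_L2 (f : Lp St 2 (volume : Measure E3)) :
    HasFourierFunction (f : 𝓢'(E3, St)) (𝓕 f : Lp St 2 (volume : Measure E3)) := by
  intro g
  refine ⟨?_, ?_⟩
  · have h1 : MemLp (g : E3 → ℂ) 2 volume := g.memLp 2
    exact memLp_one_iff_integrable.1 ((Lp.memLp _).smul h1)
  · rw [Lp.fourier_toTemperedDistribution_eq, Lp.toTemperedDistribution_apply]

/-- Supplies the distributions `G(t) * f`: the symbol and `f̂` are both essentially bounded, and an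
`L^∞` function has a tempered inverse transform. -/
theorem exists_hasFourierFunction_of_bounded {h : E3 → St} {C : ℝ}
    (hm : AEStronglyMeasurable h volume) (hC : ∀ᵐ w, ‖h w‖ ≤ C) :
    ∃ T : 𝓢'(E3, St), HasFourierFunction T h := by
  have hh : MemLp h ∞ volume := memLp_top_of_bound hm C hC
  refine ⟨𝓕⁻ ((hh.toLp h : Lp St ∞ (volume : Measure E3)) : 𝓢'(E3, St)), fun g =>
    ⟨integrable_schwartz_smul_Lp_top g hm hC, ?_⟩⟩
  rw [FourierTransform.fourier_fourierInv_eq, Lp.toTemperedDistribution_apply]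
  apply integral_congr_ae
  filter_upwards [hh.coeFn_toLp] with w hw
  rw [hw]

theorem HasFourierFunction.lineDeriv {T : 𝓢'(E3, St)} {h : E3 → St} (hT : HasFourierFunction T h)
    (j : Fin 3) :
    HasFourierFunction (∂_{unitVec j} T) fun w => (2 * Real.pi * Complex.I * (w j : ℂ)) • h w := by
  intro g
  have htg : (fun w : E3 => ((inner ℝ w (unitVec j) : ℝ) : ℂ)).HasTemperateGrowth := by fun_prop
  obtain ⟨h1, h2⟩ := hT ((2 * Real.pi * Complex.I) •
    SchwartzMap.smulLeftCLM ℂ (fun w : E3 => ((inner ℝ w (unitVec j) : ℝ) : ℂ)) g)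
  have hpt : ∀ w, ((2 * Real.pi * Complex.I) • SchwartzMap.smulLeftCLM ℂ
      (fun w : E3 => ((inner ℝ w (unitVec j) : ℝ) : ℂ)) g) w • h w =
      g w • (2 * Real.pi * Complex.I * (w j : ℂ)) • h w := by
    intro w
    have hin : inner ℝ w (unitVec j) = w j := by
      simp [unitVec, EuclideanSpace.inner_single_right]
    rw [_root_.smul_apply, SchwartzMap.smulLeftCLM_apply_apply htg, hin, smul_smul (g w)]
    congr 1
    simp only [smul_eq_mul]
    ring
  simp only [hpt] at h1 h2
  refine ⟨h1, ?_⟩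
  rw [← h2, TemperedDistribution.fourier_lineDerivOp_eq, map_smul]
  rfl

/-- The symbol of `D^l`. -/
def derivSymbol (l : Fin 3 → ℕ) (w : E3) : ℂ :=
  (2 * Real.pi * Complex.I * (w 0 : ℂ)) ^ l 0 * ((2 * Real.pi * Complex.I * (w 1 : ℂ)) ^ l 1 *
    (2 * Real.pi * Complex.I * (w 2 : ℂ)) ^ l 2)

theorem HasFourierFunction.iterate_lineDeriv {T : 𝓢'(E3, St)} {h : E3 → St}
    (hT : HasFourierFunction T h) (j : Fin 3) (n : ℕ) :
    HasFourierFunction ((fun S : 𝓢'(E3, St) => ∂_{unitVec j} S)^[n] T)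
      fun w => (2 * Real.pi * Complex.I * (w j : ℂ)) ^ n • h w := by
  induction n with
  | zero => simpa using hT
  | succ n ih =>
    rw [Function.iterate_succ_apply']
    convert! ih.lineDeriv j using 2 with w
    rw [smul_smul, pow_succ']

theorem HasFourierFunction.multiDeriv {T : 𝓢'(E3, St)} {h : E3 → St}
    (hT : HasFourierFunction T h) (l : Fin 3 → ℕ) :
    HasFourierFunction (multiDeriv l T) fun w => derivSymbol l w • h w := by
  have h := ((hT.iterate_lineDeriv 2 (l 2)).iterate_lineDeriv 1 (l 1)).iterate_lineDeriv 0 (l 0)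
  simp only [smul_smul] at h
  exact h

theorem continuous_derivSymbol (l : Fin 3 → ℕ) : Continuous (derivSymbol l) := by
  unfold derivSymbol
  fun_prop

theorem norm_derivSymbol_le (l : Fin 3 → ℕ) (w : E3) :
    ‖derivSymbol l w‖ ≤ ‖(2 * Real.pi) • w‖ ^ (l 0 + (l 1 + l 2)) := by
  have h : ∀ j, ‖2 * Real.pi * Complex.I * (w j : ℂ)‖ ≤ ‖(2 * Real.pi) • w‖ := by
    intro j
    have := PiLp.norm_apply_le ((2 * Real.pi) • w) j
    simpa [abs_of_pos Real.pi_pos] using this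
  rw [derivSymbol, norm_mul, norm_mul, norm_pow, norm_pow, norm_pow, pow_add, pow_add]
  gcongr <;> exact h _

/-! ### Plancherel for the distributional `L²` norm -/

theorem HasFourierFunction.l2Norm_le {T : 𝓢'(E3, St)} {h : E3 → St} (hT : HasFourierFunction T h)
    (hm : AEStronglyMeasurable h volume) : l2Norm T ≤ eLpNorm h 2 volume := by
  by_cases hfin : eLpNorm h 2 volume = ⊤
  · rw [hfin]; exact le_top
  have hh : MemLp h 2 volume := ⟨hm, lt_top_iff_ne_top.2 hfin⟩
  set H : Lp St 2 (volume : Measure E3) := hh.toLp h with hH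
  have hT' : ((𝓕⁻ H : Lp St 2 (volume : Measure E3)) : 𝓢'(E3, St)) = T := by
    rw [← Lp.fourierInv_toTemperedDistribution_eq]
    have : (H : 𝓢'(E3, St)) = 𝓕 T := by
      ext1 g
      rw [(hT g).2, Lp.toTemperedDistribution_apply]
      apply integral_congr_ae
      filter_upwards [hh.coeFn_toLp] with w hw
      rw [hw]
    rw [this, FourierTransform.fourierInv_fourier_eq]
  refine (iInf₂_le (𝓕⁻ H) hT').trans ?_
  have hn : ‖𝓕⁻ H‖ = ‖H‖ := by
    rw [← Lp.norm_fourier_eq (𝓕⁻ H), FourierTransform.fourier_fourierInv_eq]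
  rw [← ofReal_norm, hn, ofReal_norm, hH, Lp.enorm_toLp]

/-- Smooth compactly supported functions are Schwartz, and they already determine a locally
integrable function almost everywhere. -/
theorem HasFourierFunction.ae_eq {T : 𝓢'(E3, St)} {h h' : E3 → St} (hT : HasFourierFunction T h)
    (hT' : HasFourierFunction T h') (hl : LocallyIntegrable h volume)
    (hl' : LocallyIntegrable h' volume) : h =ᵐ[volume] h' := by
  refine ae_eq_of_integral_contDiff_smul_eq hl hl' fun g g_smooth g_cpt => ?_
  have hg₁ : HasCompactSupport (Complex.ofRealCLM ∘ g) := g_cpt.comp_left rfl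
  have hg₂ : ContDiff ℝ ∞ (Complex.ofRealCLM ∘ g) := by fun_prop
  have := ((hT (hg₁.toSchwartzMap hg₂)).2).symm.trans (hT' (hg₁.toSchwartzMap hg₂)).2
  simpa using this

/-- This direction turns a bound by `ξ^l f̂` in `L²` into one by `‖D^l f‖`. When no `L²` function
represents `T`, the infimum is empty and equals `∞`. -/
theorem HasFourierFunction.le_l2Norm {T : 𝓢'(E3, St)} {h : E3 → St} (hT : HasFourierFunction T h)
    (hl : LocallyIntegrable h volume) : eLpNorm h 2 volume ≤ l2Norm T := by
  refine le_iInf₂ fun g hg => ?_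
  have h1 := hasFourierFunction_L2 g
  rw [hg] at h1
  have h2 := hT.ae_eq h1 hl ((Lp.memLp _).locallyIntegrable one_le_two)
  rw [eLpNorm_congr_ae h2, ← Lp.enorm_def, ← ofReal_norm, Lp.norm_fourier_eq,
    ofReal_norm]

theorem isMultiplierImage_iff {m : E3 → Matrix Idx Idx ℂ} {f : Lp St 1 (volume : Measure E3)}
    {T : 𝓢'(E3, St)} :
    IsMultiplierImage m f T ↔ HasFourierFunction T fun w =>
      Matrix.toEuclideanLin (m ((2 * Real.pi) • w)) (𝓕 (f : E3 → St) w) :=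
  Iff.rfl

/-! ### Gaussian weights -/

/-- Half of the Gaussian absorbs the power: `y^k ≤ k! e^y`, and `y` is at most `1/(2a) + a y²/2`. -/
theorem pow_mul_exp_neg_mul_sq_le {a : ℝ} (ha : 0 < a) (k : ℕ) {y : ℝ} (hy : 0 ≤ y) :
    y ^ k * Real.exp (-(a * y ^ 2)) ≤
      (k.factorial * Real.exp (1 / (2 * a))) * Real.exp (-(a / 2 * y ^ 2)) := by
  have h1 : y ^ k ≤ k.factorial * Real.exp y := by
    have := Real.pow_div_factorial_le_exp y hy k
    rwa [div_le_iff₀' (by positivity)] at this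
  have h2 : y ≤ 1 / (2 * a) + a / 2 * y ^ 2 := by
    rw [← sub_nonneg]
    have : 1 / (2 * a) + a / 2 * y ^ 2 - y = (a * y - 1) ^ 2 / (2 * a) := by
      field_simp
      ring
    rw [this]
    positivity
  calc y ^ k * Real.exp (-(a * y ^ 2))
      ≤ (k.factorial * Real.exp (1 / (2 * a) + a / 2 * y ^ 2)) * Real.exp (-(a * y ^ 2)) := by
        gcongr
        exact h1.trans (by gcongr)
    _ = _ := by
        rw [mul_assoc, ← Real.exp_add, mul_assoc, ← Real.exp_add]
        congr 2
        ring

theorem integrable_gaussian {b : ℝ} (hb : 0 < b) :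
    Integrable fun w : E3 => Real.exp (-b * ‖w‖ ^ 2) := by
  have h := (GaussianFourier.integrable_cexp_neg_mul_sq_norm_add (V := E3) (b := (b : ℂ))
    (by simpa using hb) 0 0).norm
  refine h.congr (Filter.Eventually.of_forall fun w => ?_)
  simp only [Complex.norm_exp]
  congr 1
  simp [← Complex.ofReal_pow]

theorem eLpNorm_gaussian {b : ℝ} (hb : 0 < b) :
    eLpNorm (fun w : E3 => Real.exp (-(b / 2 * ‖w‖ ^ 2))) 2 volume
      = ENNReal.ofReal ((Real.pi / b) ^ (3 / 4 : ℝ)) := by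
  have hsq : ∀ w : E3, Real.exp (-(b / 2 * ‖w‖ ^ 2)) ^ 2 = Real.exp (-b * ‖w‖ ^ 2) := by
    intro w
    rw [← Real.exp_nat_mul]
    congr 1
    push_cast
    ring
  have hc : Continuous fun w : E3 => Real.exp (-(b / 2 * ‖w‖ ^ 2)) := by fun_prop
  have hmem : MemLp (fun w : E3 => Real.exp (-(b / 2 * ‖w‖ ^ 2))) 2 volume := by
    rw [memLp_two_iff_integrable_sq hc.aestronglyMeasurable]
    simp only [hsq]
    exact integrable_gaussian hb
  rw [hmem.eLpNorm_eq_integral_rpow_norm two_ne_zero ENNReal.ofNat_ne_top]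
  congr 1
  have : ∀ w : E3, ‖Real.exp (-(b / 2 * ‖w‖ ^ 2))‖ ^ (2 : ℝ≥0∞).toReal
      = Real.exp (-b * ‖w‖ ^ 2) := by
    intro w
    rw [← hsq, Real.norm_eq_abs, abs_of_pos (Real.exp_pos _)]
    norm_num
  simp only [this]
  rw [GaussianFourier.integral_rexp_neg_mul_sq_norm hb, ← Real.rpow_mul (by positivity)]
  congr 1
  simp
  norm_num

/-- The weights `|ξ|ᵏ e^{-a τ |ξ|²}`, `ξ = 2πw`, have `L²` norm of order `τ^{-3/4-k/2}`. -/
theorem exists_eLpNorm_pow_mul_gaussian_le {a : ℝ} (ha : 0 < a) (k : ℕ) :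
    ∃ C : ℝ, 0 < C ∧ ∀ τ : ℝ, 0 < τ →
      eLpNorm (fun w : E3 => ‖(2 * Real.pi) • w‖ ^ k *
          Real.exp (-(a * (τ * ‖(2 * Real.pi) • w‖ ^ 2)))) 2 volume ≤
        ENNReal.ofReal (C * τ ^ (-(3 / 4 : ℝ) - (k : ℝ) / 2)) := by
  set M : ℝ := k.factorial * Real.exp (1 / (2 * a)) with hM
  have hM0 : 0 < M := by positivity
  have hπ := Real.pi_pos
  refine ⟨M * (Real.pi / (a * (2 * Real.pi) ^ 2)) ^ (3 / 4 : ℝ), by positivity, fun τ hτ => ?_⟩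
  have hb : 0 < a * τ * (2 * Real.pi) ^ 2 := by positivity
  have hk : (Real.sqrt τ) ^ k = τ ^ ((k : ℝ) / 2) := by
    rw [Real.sqrt_eq_rpow, ← Real.rpow_natCast, ← Real.rpow_mul hτ.le]
    congr 1
    ring
  have hpt : ∀ w : E3, ‖‖(2 * Real.pi) • w‖ ^ k *
      Real.exp (-(a * (τ * ‖(2 * Real.pi) • w‖ ^ 2)))‖ ≤
      ((M * τ ^ (-((k : ℝ) / 2))) •
        fun w : E3 => Real.exp (-((a * τ * (2 * Real.pi) ^ 2) / 2 * ‖w‖ ^ 2))) w := by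
    intro w
    rw [Real.norm_of_nonneg (by positivity)]
    set x := ‖(2 * Real.pi) • w‖ with hx
    have hx' : x = 2 * Real.pi * ‖w‖ := by
      rw [hx, norm_smul, Real.norm_of_nonneg (by positivity)]
    -- Rescaling by `√τ` extracts `τ^(-k/2)`; the remaining Gaussian supplies `τ^(-3/4)`.
    have h1 := pow_mul_exp_neg_mul_sq_le ha k (y := Real.sqrt τ * x) (by positivity)
    rw [mul_pow, mul_pow, Real.sq_sqrt hτ.le, hk, ← hM] at h1
    have h2 : τ ^ (-((k : ℝ) / 2)) * τ ^ ((k : ℝ) / 2) = 1 := by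
      rw [← Real.rpow_add hτ]; simp
    have h3 := mul_le_mul_of_nonneg_left h1 (Real.rpow_nonneg hτ.le (-((k : ℝ) / 2)))
    calc x ^ k * Real.exp (-(a * (τ * x ^ 2)))
        = τ ^ (-((k : ℝ) / 2)) * (τ ^ ((k : ℝ) / 2) * x ^ k * Real.exp (-(a * (τ * x ^ 2)))) := by
          linear_combination -(x ^ k * Real.exp (-(a * (τ * x ^ 2)))) * h2
      _ ≤ _ := h3
      _ = _ := by
          simp only [Pi.smul_apply, smul_eq_mul]
          rw [hx', ← mul_assoc, mul_comm (τ ^ (-((k : ℝ) / 2))) M]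
          congr 3
          ring
  refine (eLpNorm_mono_real hpt).trans ?_
  rw [eLpNorm_const_smul, eLpNorm_gaussian hb, Real.enorm_of_nonneg (by positivity),
    ← ENNReal.ofReal_mul (by positivity)]
  apply le_of_eq
  congr 1
  have h4 : Real.pi / (a * τ * (2 * Real.pi) ^ 2) = Real.pi / (a * (2 * Real.pi) ^ 2) * τ⁻¹ := by
    field_simp
  rw [h4, Real.mul_rpow (by positivity) (by positivity), Real.inv_rpow hτ.le, ← Real.rpow_neg hτ.le,
    sub_eq_add_neg, Real.rpow_add hτ]
  ring

/-! ### Decay estimates -/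

theorem le_rate_of_norm_le {ξ : E3} {R : ℝ} (h : ‖ξ‖ ≤ R) : ‖ξ‖ ^ 2 / (1 + R ^ 2) ≤ rate ξ := by
  unfold rate
  gcongr

theorem half_le_rate {ξ : E3} (h : 1 ≤ ‖ξ‖) : 1 / 2 ≤ rate ξ := by
  unfold rate
  rw [div_le_div_iff₀ two_pos (by positivity)]
  nlinarith

/-- Replacing `t` by `1 + t` costs only the factor `exp r`, because `|ξ|²/(1 + R²) ≤ 1`. This keeps
the estimate finite down to `t = 0`. -/
theorem exp_neg_rate_le {r R t : ℝ} (hr : 0 < r) (ht : 0 ≤ t) {ξ : E3} (h : ‖ξ‖ ≤ R) :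
    Real.exp (-(r * rate ξ * t)) ≤
      Real.exp r * Real.exp (-(r / (1 + R ^ 2) * ((1 + t) * ‖ξ‖ ^ 2))) := by
  rw [← Real.exp_add]
  apply Real.exp_le_exp.2
  have h1 := mul_le_mul_of_nonneg_right (mul_le_mul_of_nonneg_left (le_rate_of_norm_le h) hr.le) ht
  have h2 : ‖ξ‖ ^ 2 / (1 + R ^ 2) ≤ 1 := by
    rw [div_le_one (by positivity)]
    nlinarith [norm_nonneg ξ]
  have h3 := mul_le_mul_of_nonneg_left h2 hr.le
  have h4 : r / (1 + R ^ 2) * ((1 + t) * ‖ξ‖ ^ 2)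
      = r * (‖ξ‖ ^ 2 / (1 + R ^ 2)) + r * (‖ξ‖ ^ 2 / (1 + R ^ 2)) * t := by ring
  linarith

/-- The pointwise bound of `ξ^l Ĝ f̂` at low frequencies. -/
theorem norm_derivSymbol_smul_le_of_norm_le {K r R t F : ℝ} (hK : 0 ≤ K) (hr : 0 < r) (ht : 0 ≤ t)
    (l : Fin 3 → ℕ) {w : E3} (hw : ‖(2 * Real.pi) • w‖ ≤ R) {y z : St}
    (hz : ‖z‖ ≤ F)
    (hy : ‖y‖ ≤ K * Real.exp (-(r * rate ((2 * Real.pi) • w) * t)) * ‖z‖) :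
    ‖derivSymbol l w • y‖ ≤ K * Real.exp r * F *
      (‖(2 * Real.pi) • w‖ ^ (l 0 + (l 1 + l 2)) *
        Real.exp (-(r / (1 + R ^ 2) * ((1 + t) * ‖(2 * Real.pi) • w‖ ^ 2)))) := by
  have hF : 0 ≤ F := (norm_nonneg z).trans hz
  rw [norm_smul]
  calc ‖derivSymbol l w‖ * ‖y‖
      ≤ ‖(2 * Real.pi) • w‖ ^ (l 0 + (l 1 + l 2)) * (K * (Real.exp r *
        Real.exp (-(r / (1 + R ^ 2) * ((1 + t) * ‖(2 * Real.pi) • w‖ ^ 2)))) * F) := by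
        apply mul_le_mul (norm_derivSymbol_le l w) _ (norm_nonneg _) (by positivity)
        refine hy.trans ?_
        gcongr
        exact exp_neg_rate_le hr ht hw
    _ = _ := by ring

/-- Both exceptional sets are spheres, the origin being the one of radius zero, and hence null. -/
theorem ae_two_pi_smul_regular :
    ∀ᵐ w : E3, (2 * Real.pi) • w ≠ 0 ∧ ‖(2 * Real.pi) • w‖ ≠ 1 / 2 := by
  have hπ : 0 < 2 * Real.pi := by positivity
  have h1 : ∀ᵐ w : E3, w ∉ Metric.sphere (0 : E3) 0 :=
    measure_eq_zero_iff_ae_notMem.1 (Measure.addHaar_sphere _ _ _)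
  have h2 : ∀ᵐ w : E3, w ∉ Metric.sphere (0 : E3) (1 / 2 / (2 * Real.pi)) :=
    measure_eq_zero_iff_ae_notMem.1 (Measure.addHaar_sphere _ _ _)
  filter_upwards [h1, h2] with w hw1 hw2
  simp only [mem_sphere_iff_norm, sub_zero] at hw1 hw2
  refine ⟨fun h => hw1 ?_, fun h => hw2 ?_⟩
  · rw [smul_eq_zero] at h
    rw [h.resolve_left hπ.ne', norm_zero]
  · rw [norm_smul, Real.norm_of_nonneg hπ.le] at h
    rw [eq_div_iff hπ.ne', mul_comm]
    exact h

theorem sum_of_mem_piAntidiag {k : ℕ} {l : Fin 3 → ℕ}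
    (hl : l ∈ Finset.piAntidiag (Finset.univ : Finset (Fin 3)) k) : l 0 + (l 1 + l 2) = k := by
  have := (Finset.mem_piAntidiag.1 hl).1
  rw [Fin.sum_univ_three] at this
  omega

/-! ### The decay estimates for both Green matrices -/

section Green

variable {c : ℝ} {G : ℝ → E3 → Matrix Idx Idx ℂ}

theorem measurable_green_fourier
    (hG : G ∈ ({greenFormula c, greenExp c} : Set (ℝ → E3 → Matrix Idx Idx ℂ))) (t : ℝ)
    (f : Lp St 1 (volume : Measure E3)) :
    Measurable fun w : E3 =>
      Matrix.toEuclideanLin (G t ((2 * Real.pi) • w)) (𝓕 (f : E3 → St) w) :=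
  measurable_toEuclideanLin_apply
    (m := fun w => G t ((2 * Real.pi) • w))
    (fun i j => (measurable_green hG t i j).comp (measurable_const_smul _))
    (continuous_fourier_coe f).measurable

theorem ae_norm_green_fourier_le (hc : 0 < c)
    (hG : G ∈ ({greenFormula c, greenExp c} : Set (ℝ → E3 → Matrix Idx Idx ℂ))) {t : ℝ}
    (ht : 0 ≤ t) (f : Lp St 1 (volume : Measure E3)) :
    ∀ᵐ w : E3, ‖Matrix.toEuclideanLin (G t ((2 * Real.pi) • w)) (𝓕 (f : E3 → St) w)‖ ≤
      growthConst c * Real.exp (-(decayConst c * rate ((2 * Real.pi) • w) * t))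
        * ‖𝓕 (f : E3 → St) w‖ := by
  filter_upwards [ae_two_pi_smul_regular] with w hw
  exact norm_green_apply_le hc hG hw.1 hw.2 ht _

theorem growthConst_mul_exp_mul_le (hc : 0 < c) {t : ℝ} (ht : 0 ≤ t)
    (f : Lp St 1 (volume : Measure E3)) (w : E3) :
    growthConst c * Real.exp (-(decayConst c * rate ((2 * Real.pi) • w) * t))
        * ‖𝓕 (f : E3 → St) w‖ ≤ growthConst c * ‖f‖ := by
  have h1 : Real.exp (-(decayConst c * rate ((2 * Real.pi) • w) * t)) ≤ 1 := by
    rw [Real.exp_le_one_iff, neg_nonpos]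
    exact mul_nonneg (mul_nonneg (decayConst_pos hc).le (rate_nonneg _)) ht
  have h2 := norm_fourier_coe_le f w
  have h3 := (growthConst_pos hc).le
  calc _ ≤ growthConst c * 1 * ‖f‖ := by gcongr
    _ = _ := by ring

/-- The constant in the decay estimate for frequencies at most `R`. -/
theorem exists_eLpNorm_low_le (hc : 0 < c) (R : ℝ) (k : ℕ) :
    ∃ C : ℝ, 0 < C ∧ ∀ t : ℝ, 0 ≤ t → ∀ f : Lp St 1 (volume : Measure E3),
      eLpNorm (fun w : E3 => growthConst c * Real.exp (decayConst c) * ‖f‖ *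
        (‖(2 * Real.pi) • w‖ ^ k * Real.exp (-(decayConst c / (1 + R ^ 2) *
          ((1 + t) * ‖(2 * Real.pi) • w‖ ^ 2))))) 2 volume ≤
      ENNReal.ofReal (C * (1 + t) ^ (-(3 / 4 : ℝ) - (k : ℝ) / 2)) * ‖f‖ₑ := by
  have hr := decayConst_pos hc
  have hK := growthConst_pos hc
  obtain ⟨C, hC, h⟩ := exists_eLpNorm_pow_mul_gaussian_le
    (a := decayConst c / (1 + R ^ 2)) (by positivity) k
  refine ⟨growthConst c * Real.exp (decayConst c) * C, by positivity, fun t ht f => ?_⟩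
  have h1 := eLpNorm_const_smul (growthConst c * Real.exp (decayConst c) * ‖f‖)
    (fun w : E3 => ‖(2 * Real.pi) • w‖ ^ k * Real.exp (-(decayConst c / (1 + R ^ 2) *
          ((1 + t) * ‖(2 * Real.pi) • w‖ ^ 2)))) 2 volume
  refine h1.le.trans ((mul_le_mul_right (h (1 + t) (by linarith)) _).trans_eq ?_)
  rw [Real.enorm_of_nonneg (by positivity), ← ofReal_norm f, ← ENNReal.ofReal_mul (by positivity),
    ← ENNReal.ofReal_mul (by positivity)]
  congr 1
  ring

theorem exists_green_decay (hc : 0 < c) (k : ℕ) :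
    ∃ C : ℝ, 0 < C ∧
      ∀ G ∈ ({greenFormula c, greenExp c} : Set (ℝ → E3 → Matrix Idx Idx ℂ)),
      ∀ t : ℝ, 0 ≤ t → ∀ f : Lp St 1 (volume : Measure E3),
        ∃ T : 𝓢'(E3, St), IsMultiplierImage (G t) f T ∧
          gradNorm k T ≤
            ENNReal.ofReal (C * (1 + t) ^ (-(3 / 4 : ℝ) - (k : ℝ) / 2)) * ‖f‖ₑ
              + ENNReal.ofReal (C * Real.exp (-(decayConst c / 2) * t)) *
                  gradNorm k (f : 𝓢'(E3, St)) := by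
  have hr := decayConst_pos hc
  have hK := growthConst_pos hc
  obtain ⟨C₀, hC₀, hlow⟩ := exists_eLpNorm_low_le hc 1 k
  set n := (Finset.piAntidiag (Finset.univ : Finset (Fin 3)) k).card with hn
  -- One constant serves both terms: `n` multi-indices each contribute `C₀` at low frequencies,
  -- while at high frequencies the sum over them is already contained in `gradNorm`.
  refine ⟨n * C₀ + growthConst c, by positivity, fun G hG t ht f => ?_⟩
  set h : E3 → St := fun w =>
    Matrix.toEuclideanLin (G t ((2 * Real.pi) • w)) (𝓕 (f : E3 → St) w) with hh
  have hm : Measurable h := measurable_green_fourier hG t f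
  have hb := ae_norm_green_fourier_le hc hG ht f
  obtain ⟨T, hT⟩ := exists_hasFourierFunction_of_bounded hm.aestronglyMeasurable
    (hb.mono fun w hw => hw.trans (growthConst_mul_exp_mul_le hc ht f w))
  refine ⟨T, isMultiplierImage_iff.2 hT, ?_⟩
  set q : ℝ := (1 + t) ^ (-(3 / 4 : ℝ) - (k : ℝ) / 2) with hq
  have hq0 : 0 ≤ q := Real.rpow_nonneg (by linarith) _
  have hl : ∀ l ∈ Finset.piAntidiag (Finset.univ : Finset (Fin 3)) k,
      l2Norm (multiDeriv l T) ≤ ENNReal.ofReal (C₀ * q) * ‖f‖ₑ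
        + ENNReal.ofReal (growthConst c * Real.exp (-(decayConst c / 2) * t)) *
          l2Norm (multiDeriv l (f : 𝓢'(E3, St))) := by
    intro l hl
    have hcont : Continuous fun w : E3 => derivSymbol l w • 𝓕 (f : E3 → St) w :=
      (continuous_derivSymbol l).smul (continuous_fourier_coe f)
    have hf := ((hasFourierFunction_L1 f).multiDeriv l).le_l2Norm hcont.locallyIntegrable
    refine ((hT.multiDeriv l).l2Norm_le
      ((continuous_derivSymbol l).measurable.smul hm).aestronglyMeasurable).trans ?_
    have hkl := sum_of_mem_piAntidiag hl
    let lowf : E3 → ℝ := fun w => growthConst c * Real.exp (decayConst c) * ‖f‖ *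
        (‖(2 * Real.pi) • w‖ ^ k * Real.exp (-(decayConst c / (1 + 1 ^ 2) *
          ((1 + t) * ‖(2 * Real.pi) • w‖ ^ 2))))
    let highf : E3 → ℝ := (growthConst c * Real.exp (-(decayConst c / 2) * t)) •
      fun w : E3 => ‖derivSymbol l w • 𝓕 (f : E3 → St) w‖
    have hlow0 : ∀ w, 0 ≤ lowf w := fun w => by positivity
    have hhigh0 : ∀ w, 0 ≤ highf w := fun w => by
      simp only [highf, Pi.smul_apply, smul_eq_mul]; positivity
    have hlowc : Continuous lowf := by fun_prop
    have hhighc : Continuous highf := hcont.norm.const_smul _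
    have hpt : ∀ᵐ w, ‖derivSymbol l w • h w‖ ≤ (lowf + highf) w := by
      filter_upwards [hb] with w hw
      rw [Pi.add_apply]
      -- Below the threshold `|ξ| = 1` the Gaussian majorant applies. Above it the rate is at least
      -- `1/2`, whence the exponent `decayConst c / 2`.
      by_cases hw1 : ‖(2 * Real.pi) • w‖ ≤ 1
      · have := norm_derivSymbol_smul_le_of_norm_le hK.le hr ht l hw1 (norm_fourier_coe_le f w) hw
        rw [hkl] at this
        exact this.trans (le_add_of_nonneg_right (hhigh0 w))
      · refine le_trans ?_ (le_add_of_nonneg_left (hlow0 w))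
        have hρ := half_le_rate (le_of_not_ge hw1)
        simp only [highf, Pi.smul_apply, smul_eq_mul, norm_smul]
        have hexp : Real.exp (-(decayConst c * rate ((2 * Real.pi) • w) * t)) ≤
            Real.exp (-(decayConst c / 2) * t) := by
          apply Real.exp_le_exp.2
          have := mul_le_mul_of_nonneg_right (mul_le_mul_of_nonneg_left hρ hr.le) ht
          linarith
        calc ‖derivSymbol l w‖ * ‖h w‖ ≤ ‖derivSymbol l w‖ *
              (growthConst c * Real.exp (-(decayConst c / 2) * t) * ‖𝓕 (f : E3 → St) w‖) := by
              gcongr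
              exact hw.trans (by gcongr)
          _ = _ := by ring
    refine (eLpNorm_mono_ae_real hpt).trans ?_
    refine (eLpNorm_add_le hlowc.aestronglyMeasurable hhighc.aestronglyMeasurable
      one_le_two).trans ?_
    refine add_le_add (hlow t ht f) ?_
    rw [eLpNorm_const_smul, eLpNorm_norm, Real.enorm_of_nonneg (by positivity)]
    exact mul_le_mul_right hf _
  refine (Finset.sum_le_sum hl).trans ?_
  rw [Finset.sum_add_distrib, Finset.sum_const, ← Finset.mul_sum, ← hn, nsmul_eq_mul, ← mul_assoc]
  refine add_le_add (mul_le_mul_left ?_ _) (mul_le_mul_left (ENNReal.ofReal_le_ofReal ?_) _)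
  · rw [← ENNReal.ofReal_natCast, ← ENNReal.ofReal_mul (by positivity)]
    apply ENNReal.ofReal_le_ofReal
    nlinarith [mul_nonneg hK.le hq0]
  · apply mul_le_mul_of_nonneg_right _ (Real.exp_pos _).le
    have : 0 ≤ (n : ℝ) * C₀ := by positivity
    linarith

/-- Only `|χ| ≤ 1` and the vanishing of `χ` for `|ξ| ≥ R₀` enter the bound, so the constant is
independent of `r₀` and of `χ`. -/
theorem exists_green_low_decay (hc : 0 < c) (R₀ : ℝ) (k : ℕ) :
    ∃ C : ℝ, 0 < C ∧
      ∀ G ∈ ({greenFormula c, greenExp c} : Set (ℝ → E3 → Matrix Idx Idx ℂ)),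
      ∀ (r₀ : ℝ) (χ : E3 → ℝ), IsLowCutoff r₀ R₀ χ →
      ∀ t : ℝ, 0 ≤ t → ∀ f : Lp St 1 (volume : Measure E3),
        ∃ T : 𝓢'(E3, St), IsMultiplierImage (fun ξ => (χ ξ : ℂ) • G t ξ) f T ∧
          gradNorm k T ≤
            ENNReal.ofReal (C * (1 + t) ^ (-(3 / 4 : ℝ) - (k : ℝ) / 2)) * ‖f‖ₑ := by
  have hr := decayConst_pos hc
  have hK := growthConst_pos hc
  obtain ⟨C₀, hC₀, hlow⟩ := exists_eLpNorm_low_le hc R₀ k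
  set n := (Finset.piAntidiag (Finset.univ : Finset (Fin 3)) k).card with hn
  -- Taking `n + 1` instead of `n` makes the constant positive without showing that multi-indices of
  -- length `k` exist.
  refine ⟨(n + 1) * C₀, by positivity, fun G hG r₀ χ hχ t ht f => ?_⟩
  set h : E3 → St := fun w =>
    Matrix.toEuclideanLin ((χ ((2 * Real.pi) • w) : ℂ) • G t ((2 * Real.pi) • w))
      (𝓕 (f : E3 → St) w) with hh
  have hval : ∀ w, h w = (χ ((2 * Real.pi) • w) : ℂ) •
      Matrix.toEuclideanLin (G t ((2 * Real.pi) • w)) (𝓕 (f : E3 → St) w) := by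
    intro w
    rw [hh]
    simp only [map_smul, LinearMap.smul_apply]
  have hχm : Measurable fun w : E3 => (χ ((2 * Real.pi) • w) : ℂ) :=
    (Complex.continuous_ofReal.comp (hχ.smooth.continuous.comp (continuous_const_smul _))).measurable
  have hm : Measurable h := by
    rw [funext hval]
    exact hχm.smul (measurable_green_fourier hG t f)
  have hχ1 : ∀ ξ, ‖(χ ξ : ℂ)‖ ≤ 1 := fun ξ => by
    rw [Complex.norm_real, Real.norm_of_nonneg (hχ.nonneg ξ)]
    exact hχ.le_one ξ
  have hb : ∀ᵐ w : E3, ‖h w‖ ≤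
      growthConst c * Real.exp (-(decayConst c * rate ((2 * Real.pi) • w) * t))
        * ‖𝓕 (f : E3 → St) w‖ := by
    filter_upwards [ae_norm_green_fourier_le hc hG ht f] with w hw
    rw [hval, norm_smul]
    exact (mul_le_of_le_one_left (norm_nonneg _) (hχ1 _)).trans hw
  obtain ⟨T, hT⟩ := exists_hasFourierFunction_of_bounded hm.aestronglyMeasurable
    (hb.mono fun w hw => hw.trans (growthConst_mul_exp_mul_le hc ht f w))
  refine ⟨T, isMultiplierImage_iff.2 hT, ?_⟩
  set q : ℝ := (1 + t) ^ (-(3 / 4 : ℝ) - (k : ℝ) / 2) with hq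
  have hq0 : 0 ≤ q := Real.rpow_nonneg (by linarith) _
  have hl : ∀ l ∈ Finset.piAntidiag (Finset.univ : Finset (Fin 3)) k,
      l2Norm (multiDeriv l T) ≤ ENNReal.ofReal (C₀ * q) * ‖f‖ₑ := by
    intro l hl
    refine ((hT.multiDeriv l).l2Norm_le
      ((continuous_derivSymbol l).measurable.smul hm).aestronglyMeasurable).trans ?_
    have hkl := sum_of_mem_piAntidiag hl
    refine le_trans (eLpNorm_mono_ae_real ?_) (hlow t ht f)
    filter_upwards [hb] with w hw
    by_cases hw1 : ‖(2 * Real.pi) • w‖ ≤ R₀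
    · have := norm_derivSymbol_smul_le_of_norm_le hK.le hr ht l hw1 (norm_fourier_coe_le f w) hw
      rwa [hkl] at this
    · rw [hval, hχ.eq_zero _ (le_of_not_ge hw1)]
      simp only [Complex.ofReal_zero, zero_smul, smul_zero, norm_zero]
      positivity
  refine (Finset.sum_le_sum hl).trans ?_
  rw [Finset.sum_const, ← hn, nsmul_eq_mul, ← mul_assoc, ← ENNReal.ofReal_natCast,
    ← ENNReal.ofReal_mul (by positivity)]
  refine mul_le_mul_left (ENNReal.ofReal_le_ofReal ?_) _
  nlinarith [mul_nonneg hC₀.le hq0]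

end Green

end EulerNS

end

theorem proposition4p2 (c : ℝ) (hc : 0 < c) :
    -- the explicit matrix is the Green function of the linearized operator on states `(φ, u, v)`
    -- with `div v = 0`
    (∀ (t : ℝ) (ξ : EulerNS.E3), ξ ≠ 0 → ‖ξ‖ ≠ 1 / 2 → ∀ z : EulerNS.Idx → ℂ,
      ∑ j : Fin 3, (ξ j : ℂ) * z (Sum.inr (Sum.inr j)) = 0 →
        EulerNS.greenFormula c t ξ *ᵥ z = EulerNS.greenExp c t ξ *ᵥ z) ∧
    -- decay of `G * f`
    (∃ R : ℝ, 0 < R ∧ ∀ k : ℕ, ∃ C : ℝ, 0 < C ∧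
      ∀ G ∈ ({EulerNS.greenFormula c, EulerNS.greenExp c} :
          Set (ℝ → EulerNS.E3 → Matrix EulerNS.Idx EulerNS.Idx ℂ)),
      ∀ t : ℝ, 0 ≤ t → ∀ f : Lp EulerNS.St 1 (volume : Measure EulerNS.E3),
        ∃ T : 𝓢'(EulerNS.E3, EulerNS.St), EulerNS.IsMultiplierImage (G t) f T ∧
          EulerNS.gradNorm k T ≤
            ENNReal.ofReal (C * (1 + t) ^ (-(3 / 4 : ℝ) - (k : ℝ) / 2)) * ‖f‖ₑ
              + ENNReal.ofReal (C * Real.exp (-R * t)) *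
                  EulerNS.gradNorm k (f : 𝓢'(EulerNS.E3, EulerNS.St))) ∧
    -- decay of the low-frequency part
    (∀ (R₀ : ℝ) (k : ℕ), ∃ C : ℝ, 0 < C ∧
      ∀ G ∈ ({EulerNS.greenFormula c, EulerNS.greenExp c} :
          Set (ℝ → EulerNS.E3 → Matrix EulerNS.Idx EulerNS.Idx ℂ)),
      ∀ (r₀ : ℝ) (χ : EulerNS.E3 → ℝ), EulerNS.IsLowCutoff r₀ R₀ χ →
      ∀ t : ℝ, 0 ≤ t → ∀ f : Lp EulerNS.St 1 (volume : Measure EulerNS.E3),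
        ∃ T : 𝓢'(EulerNS.E3, EulerNS.St),
          EulerNS.IsMultiplierImage (fun ξ => (χ ξ : ℂ) • G t ξ) f T ∧
          EulerNS.gradNorm k T ≤
            ENNReal.ofReal (C * (1 + t) ^ (-(3 / 4 : ℝ) - (k : ℝ) / 2)) * ‖f‖ₑ) := by
  refine ⟨fun t ξ hξ hξ' z hz => EulerNS.greenFormula_mulVec_eq_greenExp_mulVec hc t hξ hξ' z hz,
    ⟨EulerNS.decayConst c / 2, half_pos (EulerNS.decayConst_pos hc),
      fun k => EulerNS.exists_green_decay hc k⟩,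
    fun R₀ k => EulerNS.exists_green_low_decay hc R₀ k⟩
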